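/- Oriented links are nonempty, tame, oriented links in $\mathbb R^3$, i.e. disjoint unions of finitely many oriented simple closed polygons, considered up to ambient isotopy. A $\mathbb Z[t^{\pm 1/2}]$-valued invariant of oriented links is a function $\Delta$ from oriented links to $\mathbb Z[t^{\pm1/2}]$ that takes equal values on links which are ambient isotopic as oriented links. For links $L_{\beta_1},\dots,L_{\beta_k}$ that are identical outside a solid cylinder and that are, inside the cylinder, the geometric braids $\beta_1,\dots,\beta_k$ (all strands oriented downwards), write $\Delta(\beta_i)$ for $\Delta(L_{\beta_i})$. Let $\sigma_1,\sigma_2$ be the standard braid generators and $e$ the trivial braid. A link is the split union $L_1\sqcup L_2$ of two (nonempty) links if it is isotopic to the union of a copy of $L_1$ and a copy of $L_2$ that lie on opposite sides of a plane; it is a split link if it is the split union of some two links. Assume that $\Delta$ is a $\mathbb Z[t^{\pm1/2}]$-valued invariant of oriented links such that, for all links which are identical outside a cylinder and are the indicated braids inside it, $$\Delta(\sigma_1^2)+\Delta(\sigma_1^{-2})=(t+t^{-1})\,\Delta(e)\qquad(\mathrm{II}_\Delta)$$ for $2$-braids, and $$\Delta(\sigma_1\sigma_2\sigma_1^{-1})-\Delta(\sigma_1\sigma_2^{-1}\sigma_1^{-1})=\Delta(\sigma_1^{-1}\sigma_2\sigma_1)-\Delta(\sigma_1^{-1}\sigma_2^{-1}\sigma_1)\qquad(\mathrm{III}_\Delta)$$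 for $3$-braids. Then $\Delta(L)=0$ for every split link $L$. In particular, for every oriented link $L$ and the unknot $O$, $$\Delta(L\sqcup O)=0.\qquad(\mathrm{IO}_\Delta)$$ -/

import Mathlib

/-- Three-space, with coordinates `(x, y, z)`: `x` to the right, `y` away from the viewer,
`z` upwards. Only its topology, affine structure and orientation matter. -/
abbrev R3 : Type := ℝ × ℝ × ℝ

/-- The straight segment underlying a directed edge `e`, which runs from `e.1` to `e.2`. -/
def edgeSegment (e : R3 × R3) : Set R3 := segment ℝ e.1 e.2

/-- An oriented (tame) link in three-space, given as an oriented polygonal link: a nonempty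
finite set of directed edges in which every edge has exactly one successor and exactly one
predecessor, and in which two different edges meet at most in common endpoints. The components
are the directed closed polygons formed by the edges. -/
structure OrientedLink where
  edges : Set (R3 × R3)
  finite : edges.Finite
  nonempty : edges.Nonempty
  nondegenerate : ∀ e ∈ edges, e.1 ≠ e.2
  next : ∀ e ∈ edges, ∃! f, f ∈ edges ∧ f.1 = e.2
  prev : ∀ e ∈ edges, ∃! f, f ∈ edges ∧ f.2 = e.1
  embedded : ∀ e ∈ edges, ∀ f ∈ edges, e ≠ f →
    edgeSegment e ∩ edgeSegment f ⊆ {e.1, e.2} ∩ {f.1, f.2}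

/-- An ambient isotopy of three-space: a continuous family of homeomorphisms, indexed by the
unit interval, that starts at the identity. -/
def IsAmbientIsotopy (H : unitInterval × R3 → R3) : Prop :=
  Continuous H ∧ (∀ t, IsHomeomorph fun p => H (t, p)) ∧ ∀ p, H (0, p) = p

namespace OrientedLink

/-- The underlying subset of three-space. -/
def support (L : OrientedLink) : Set R3 := ⋃ e ∈ L.edges, edgeSegment e

/-- `M` is a subdivision of `L`: the same oriented subset of three-space, with possibly more
vertices. -/
def Refines (M L : OrientedLink) : Prop :=
  M.support = L.support ∧
    ∀ e ∈ M.edges, ∃ f ∈ L.edges, edgeSegment e ⊆ edgeSegment f ∧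
      ∃ r : ℝ, 0 < r ∧ e.2 - e.1 = r • (f.2 - f.1)

/-- Isotopy of oriented links: the final homeomorphism of some ambient isotopy carries the first
oriented link onto the second one. To express that orientations are preserved, both links are
subdivided so that directed edges are carried onto directed edges (this is always possible: add
the images and preimages of vertices as new vertices). The homeomorphism need not be affine on
the edges. -/
def Isotopic (L L' : OrientedLink) : Prop :=
  ∃ M M' : OrientedLink, M.Refines L ∧ M'.Refines L' ∧
    ∃ H : unitInterval × R3 → R3, IsAmbientIsotopy H ∧
      M'.edges = (fun e : R3 × R3 => (H (1, e.1), H (1, e.2))) '' M.edges ∧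
      ∀ e ∈ M.edges, (fun p => H (1, p)) '' edgeSegment e = edgeSegment (H (1, e.1), H (1, e.2))

/-- The unknot: a link isotopic to a triangle. -/
def IsUnknot (L : OrientedLink) : Prop :=
  ∃ T : OrientedLink, T.edges.ncard = 3 ∧ L.Isotopic T

/-- `L` is the split union `L₁ ⊔ L₂`: up to isotopy, `L` consists of a copy of `L₁` and a copy
of `L₂` that lie on opposite sides of a plane. -/
def IsSplitUnion (L₁ L₂ L : OrientedLink) : Prop :=
  ∃ A B M : OrientedLink, L₁.Isotopic A ∧ L₂.Isotopic B ∧ L.Isotopic M ∧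
    M.edges = A.edges ∪ B.edges ∧ (∀ p ∈ A.support, p.1 < 0) ∧ (∀ p ∈ B.support, 0 < p.1)

/-- A split link: a split union of two (nonempty) links. -/
def IsSplit (L : OrientedLink) : Prop :=
  ∃ L₁ L₂ : OrientedLink, IsSplitUnion L₁ L₂ L

end OrientedLink

/-- Letters of braid words: the trivial letter, the generators `σ i` (`1 ≤ i < n` for `n`-braids)
and their inverses. -/
inductive BraidLetter
  | one
  | sigma (i : ℕ)
  | sigmaInv (i : ℕ)

/-- The directed edges of an elementary `n`-braid between the heights `h + 1` (top) and `h`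
(bottom). Strands run downwards and have the positions `(j, 0)`, `1 ≤ j ≤ n`, at top and bottom.
The strands at the positions `i` and `i + 1` are exchanged; halfway down, the one which goes from
`i` to `i + 1` is at depth `d` and the other one at depth `-d`. -/
def crossingEdges (n i : ℕ) (d h : ℝ) : Set (R3 × R3) :=
  {e | ∃ j : ℕ, 1 ≤ j ∧ j ≤ n ∧ j ≠ i ∧ j ≠ i + 1 ∧ e = (((j : ℝ), 0, h + 1), ((j : ℝ), 0, h))} ∪
  {(((i : ℝ), 0, h + 1), ((i : ℝ) + 1 / 2, d, h + 1 / 2)),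
   (((i : ℝ) + 1 / 2, d, h + 1 / 2), ((i : ℝ) + 1, 0, h)),
   (((i : ℝ) + 1, 0, h + 1), ((i : ℝ) + 1 / 2, -d, h + 1 / 2)),
   (((i : ℝ) + 1 / 2, -d, h + 1 / 2), ((i : ℝ), 0, h))}

/-- The directed edges of the elementary `n`-braid of a letter, between the heights `h + 1` and
`h`. With this choice `sigma i` is a positive crossing. -/
def layerEdges (n : ℕ) (h : ℝ) : BraidLetter → Set (R3 × R3)
  | .one => {e | ∃ j : ℕ, 1 ≤ j ∧ j ≤ n ∧ e = (((j : ℝ), 0, h + 1), ((j : ℝ), 0, h))}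
  | .sigma i => crossingEdges n i (1 / 2) h
  | .sigmaInv i => crossingEdges n i (-(1 / 2)) h

/-- The geometric `n`-braid of a word, drawn from top to bottom: a word of length `k` lies
between the heights `k` and `0`, and its first letter is at the top. -/
def braidEdges (n : ℕ) : List BraidLetter → Set (R3 × R3)
  | [] => ∅
  | l :: w => layerEdges n w.length l ∪ braidEdges n w

/-- The solid cylinder (disc times interval) that contains the geometric `n`-braids of words of
length `k`. -/
def braidCylinder (n k : ℕ) : Set R3 :=
  Set.Icc (0 : ℝ) (n + 1) ×ˢ Set.Icc (-1 : ℝ) 1 ×ˢ Set.Icc (0 : ℝ) k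

/-- The endpoints of `n`-braids in the cylinder. -/
def braidEndpoints (n k : ℕ) : Set R3 :=
  {p | ∃ j : ℕ, 1 ≤ j ∧ j ≤ n ∧ (p = ((j : ℝ), 0, (k : ℝ)) ∨ p = ((j : ℝ), 0, 0))}

/-- The edges in `X` stay outside the cylinder, except that they may end at endpoints of the
braid. -/
def IsOutside (n k : ℕ) (X : Set (R3 × R3)) : Prop :=
  ∀ e ∈ X, edgeSegment e ∩ braidCylinder n k ⊆ braidEndpoints n k

/-- Inside the cylinder the link `L` is the braid `w`, and outside it is `X`. -/
def OrientedLink.IsBraidIn (L : OrientedLink) (n : ℕ) (w : List BraidLetter)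
    (X : Set (R3 × R3)) : Prop :=
  IsOutside n w.length X ∧ L.edges = X ∪ braidEdges n w

/-- An invariant of oriented links with values in `ℤ[t^{±1/2}]`. Here, and below, the variable
`T 1` of the ring of Laurent polynomials stands for `t^{1/2}`, so that `T 2` is `t`. -/
def IsLinkInvariant (D : OrientedLink → LaurentPolynomial ℤ) : Prop :=
  ∀ L L' : OrientedLink, L.Isotopic L' → D L = D L'

open BraidLetter LaurentPolynomial in
/-- The skein relation `D(σ₁²) + D(σ₁⁻²) = (t + t⁻¹) D(e)`, for links which are identical outside a
cylinder and are the indicated 2-braids in it. By isotopy invariance it is no restriction that the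
cylinder and the geometric braids in it are standard. -/
def SkeinRelationII (D : OrientedLink → LaurentPolynomial ℤ) : Prop :=
  ∀ (X : Set (R3 × R3)) (Lp Lm L0 : OrientedLink),
    Lp.IsBraidIn 2 [sigma 1, sigma 1] X →
    Lm.IsBraidIn 2 [sigmaInv 1, sigmaInv 1] X →
    L0.IsBraidIn 2 [one, one] X →
    D Lp + D Lm = (T 2 + T (-2)) * D L0

open BraidLetter in
/-- The skein relation
`D(σ₁σ₂σ₁⁻¹) - D(σ₁σ₂⁻¹σ₁⁻¹) = D(σ₁⁻¹σ₂σ₁) - D(σ₁⁻¹σ₂⁻¹σ₁)`, for links which are identical outside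
a cylinder and are the indicated 3-braids in it. -/
def SkeinRelationIII (D : OrientedLink → LaurentPolynomial ℤ) : Prop :=
  ∀ (X : Set (R3 × R3)) (L₁ L₂ L₃ L₄ : OrientedLink),
    L₁.IsBraidIn 3 [sigma 1, sigma 2, sigmaInv 1] X →
    L₂.IsBraidIn 3 [sigma 1, sigmaInv 2, sigmaInv 1] X →
    L₃.IsBraidIn 3 [sigmaInv 1, sigma 2, sigma 1] X →
    L₄.IsBraidIn 3 [sigmaInv 1, sigmaInv 2, sigma 1] X →
    D L₁ - D L₂ = D L₃ - D L₄

/-! Cut a split link open at one edge on each side of the separating plane. It becomes two bodies in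
`x ≤ -10` and `x ≥ 10`, each with one strand that can be manipulated in the slab between them. Let
`N` be the link with uncrossed strands, and let `Lp`, `Lm` be the links whose strands form the
clasps `σ₁²`, `σ₁⁻²`. Relation II gives `D Lp + D Lm = (t + t⁻¹) D N`.

Next, let the left strand run twice through a 3-braid with permutation `(1 3)` and the right strand
once. For `σ₁σ₂σ₁⁻¹` and `σ₁⁻¹σ₂⁻¹σ₁` the strands come apart and the link is isotopic to `N`; for
`σ₁⁻¹σ₂σ₁` it is isotopic to `Lp`; for `σ₁σ₂⁻¹σ₁⁻¹` it is isotopic to `Lm`, by an isotopy that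
includes a full turn of the left body. So relation III reads `D N - D Lm = D Lp - D N`, that is, `D
Lp + D Lm = 2 D N`. Hence `(t + t⁻¹ - 2) D N = 0`, and Laurent polynomials over `ℤ` have no zero
divisors.

Most of the work makes these isotopies rigorous. Small displacements of one vertex are ambient
isotopies (`exists_isotopic_move_vertex`), hence so are triangle moves, as far as `D` can see
(`exists_triangle_split`, `exists_triangle_merge`). `exists_normal_form` produces the two bodies. In
the slab all vertices are half-integral, so a list of triangle moves is checked by integer
arithmetic (`exists_of_connects`), whatever the bodies are. The full turn, which moves a body, is a
separate explicit isotopy (`exists_of_twist`). `eq_zero_of_isSplit` combines everything. -/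

namespace OrientedLink

/-! ### Elementary operations on polygonal links. -/

theorem eq_of_edges_eq {L M : OrientedLink} (h : L.edges = M.edges) : L = M := by
  cases L; cases M; cases h; rfl

theorem Refines.refl (L : OrientedLink) : L.Refines L :=
  ⟨rfl, fun e he => ⟨e, he, subset_rfl, 1, one_pos, (one_smul _ _).symm⟩⟩

/-- Both edges are successors of the predecessor of `e`, and successors are unique. -/
theorem eq_of_fst_eq (L : OrientedLink) {e f : R3 × R3} (he : e ∈ L.edges) (hf : f ∈ L.edges)
    (h : e.1 = f.1) : e = f := by
  obtain ⟨g, ⟨hg, hg'⟩, -⟩ := L.prev e he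
  exact (L.next g hg).unique ⟨he, hg'.symm⟩ ⟨hf, (hg'.trans h).symm⟩

theorem eq_of_snd_eq (L : OrientedLink) {e f : R3 × R3} (he : e ∈ L.edges) (hf : f ∈ L.edges)
    (h : e.2 = f.2) : e = f := by
  obtain ⟨g, ⟨hg, hg'⟩, -⟩ := L.next e he
  exact (L.prev g hg).unique ⟨he, hg'.symm⟩ ⟨hf, (hg'.trans h).symm⟩

/-- The image of a link under an injective map that carries edges onto straight segments. -/
def image (L : OrientedLink) (φ : R3 → R3) (hφ : Function.Injective φ)
    (hseg : ∀ e ∈ L.edges, φ '' edgeSegment e = edgeSegment (φ e.1, φ e.2)) : OrientedLink where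
  edges := (fun e : R3 × R3 => (φ e.1, φ e.2)) '' L.edges
  finite := L.finite.image _
  nonempty := L.nonempty.image _
  nondegenerate := by
    rintro _ ⟨e, he, rfl⟩ h
    exact L.nondegenerate e he (hφ h)
  next := by
    rintro _ ⟨e, he, rfl⟩
    obtain ⟨f, ⟨hf, hfe⟩, -⟩ := L.next e he
    refine ⟨_, ⟨⟨f, hf, rfl⟩, by simp [hfe]⟩, ?_⟩
    rintro _ ⟨⟨g, hg, rfl⟩, h⟩
    rw [L.eq_of_fst_eq hg hf ((hφ h).trans hfe.symm)]
  prev := by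
    rintro _ ⟨e, he, rfl⟩
    obtain ⟨f, ⟨hf, hfe⟩, -⟩ := L.prev e he
    refine ⟨_, ⟨⟨f, hf, rfl⟩, by simp [hfe]⟩, ?_⟩
    rintro _ ⟨⟨g, hg, rfl⟩, h⟩
    rw [L.eq_of_snd_eq hg hf ((hφ h).trans hfe.symm)]
  embedded := by
    rintro _ ⟨e, he, rfl⟩ _ ⟨f, hf, rfl⟩ hne
    rw [← hseg e he, ← hseg f hf, ← Set.image_inter hφ]
    rintro _ ⟨x, hx, rfl⟩
    obtain ⟨h1, h2⟩ := L.embedded e he f hf (fun h => hne (by rw [h])) hx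
    refine ⟨?_, ?_⟩
    · rcases h1 with h | h
      · exact Or.inl (by rw [h])
      · exact Or.inr (by rw [h]; rfl)
    · rcases h2 with h | h
      · exact Or.inl (by rw [h])
      · exact Or.inr (by rw [h]; rfl)

/-- No subdivision is needed in `Isotopic` when the final map carries every edge onto a straight
segment. -/
theorem isotopic_image (L : OrientedLink) {H : unitInterval × R3 → R3} (hH : IsAmbientIsotopy H)
    (hseg : ∀ e ∈ L.edges,
      (fun p => H (1, p)) '' edgeSegment e = edgeSegment (H (1, e.1), H (1, e.2))) :
    L.Isotopic (L.image (fun p => H (1, p)) (hH.2.1 1).injective hseg) :=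
  ⟨L, _, Refines.refl _, Refines.refl _, H, hH, rfl, hseg⟩

theorem nontrivial_of_notMem_segment {p q r : R3} (h1 : p ∉ segment ℝ r q)
    (h2 : q ∉ segment ℝ p r) : p ≠ q ∧ p ≠ r ∧ r ≠ q :=
  ⟨fun h => h1 (h ▸ right_mem_segment ℝ r p), fun h => h1 (h ▸ left_mem_segment ℝ p q),
    fun h => h2 (h ▸ right_mem_segment ℝ p r)⟩

/-- A second common point would put both segments on one ray from `r`; then the end of the shorter
one lies on the longer one, which the hypotheses forbid. -/
theorem segment_inter_segment_of_notMem {p q r : R3} (h1 : p ∉ segment ℝ r q)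
    (h2 : q ∉ segment ℝ p r) : segment ℝ p r ∩ segment ℝ r q ⊆ {r} := by
  rintro x ⟨hx1, hx2⟩
  rw [segment_symm, segment_eq_image'] at hx1
  rw [segment_eq_image'] at hx2
  obtain ⟨a, ⟨ha0, ha1⟩, rfl⟩ := hx1
  obtain ⟨b, ⟨hb0, hb1⟩, hb⟩ := hx2
  have hab : b • (q - r) = a • (p - r) := by simpa using hb
  rcases ha0.eq_or_lt with rfl | ha0
  · simp
  rcases hb0.eq_or_lt with rfl | hb0
  · rw [zero_smul] at hab; simp [← hab]
  rcases le_total a b with h | h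
  · exfalso; apply h2
    rw [segment_symm, segment_eq_image']
    refine ⟨a / b, ⟨by positivity, (div_le_one hb0).2 h⟩, ?_⟩
    have : q - r = (a / b) • (p - r) := by
      rw [div_eq_inv_mul, mul_smul, ← hab, smul_smul, inv_mul_cancel₀ hb0.ne', one_smul]
    simp [← this]
  · exfalso; apply h1
    rw [segment_eq_image']
    refine ⟨b / a, ⟨by positivity, (div_le_one ha0).2 h⟩, ?_⟩
    have : p - r = (b / a) • (q - r) := by
      rw [div_eq_inv_mul, mul_smul, hab, smul_smul, inv_mul_cancel₀ ha0.ne', one_smul]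
    simp [← this]

/-- Replace an edge `(p, q)` by the two edges `(p, r)` and `(r, q)`. -/
def splitEdge (L : OrientedLink) {p q : R3} (hpq : (p, q) ∈ L.edges) (r : R3)
    (h1 : p ∉ segment ℝ r q) (h2 : q ∉ segment ℝ p r)
    (hsep : ∀ g ∈ L.edges, g ≠ (p, q) →
      (segment ℝ p r ∪ segment ℝ r q) ∩ edgeSegment g ⊆ {p, q}) : OrientedLink where
  edges := {(p, r), (r, q)} ∪ (L.edges \ {(p, q)})
  finite := (Set.toFinite _).union (L.finite.subset Set.sdiff_subset)
  nonempty := ⟨(p, r), by simp⟩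
  nondegenerate := by
    obtain ⟨n1, n2, n3⟩ := nontrivial_of_notMem_segment h1 h2
    rintro e ((rfl | rfl) | he)
    exacts [n2, n3, L.nondegenerate e he.1]
  next := by
    obtain ⟨n1, n2, n3⟩ := nontrivial_of_notMem_segment h1 h2
    have hr : ∀ g ∈ L.edges, g ≠ (p, q) → r ∉ edgeSegment g := fun g hg hne hr => by
      rcases hsep g hg hne ⟨Or.inl (right_mem_segment ℝ p r), hr⟩ with h | h
      exacts [n2 h.symm, n3 h]
    have hr1 : ∀ g ∈ L.edges, g ≠ (p, q) → g.1 ≠ r := fun g hg hne h =>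
      hr g hg hne (h ▸ left_mem_segment ℝ g.1 g.2)
    have hr2 : ∀ g ∈ L.edges, g ≠ (p, q) → g.2 ≠ r := fun g hg hne h =>
      hr g hg hne (h ▸ right_mem_segment ℝ g.1 g.2)
    rintro e ((rfl | rfl) | ⟨he, hne⟩)
    · refine ⟨(r, q), ⟨by simp, rfl⟩, ?_⟩
      rintro f ⟨(rfl | rfl) | ⟨hf, hfne⟩, h⟩
      exacts [absurd h n2, rfl, absurd h (hr1 f hf hfne)]
    · obtain ⟨g, ⟨hg, hgq⟩, -⟩ := L.next _ hpq
      refine ⟨g, ⟨Or.inr ⟨hg, ?_⟩, hgq⟩, ?_⟩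
      · rintro rfl; exact n1 hgq
      rintro f ⟨(rfl | rfl) | ⟨hf, hfne⟩, h⟩
      exacts [absurd h n1, absurd h n3, L.eq_of_fst_eq hf hg (h.trans hgq.symm)]
    · obtain ⟨g, ⟨hg, hge⟩, -⟩ := L.next e he
      by_cases hgp : g = (p, q)
      · subst hgp
        refine ⟨(p, r), ⟨by simp, hge⟩, ?_⟩
        rintro f ⟨(rfl | rfl) | ⟨hf, hfne⟩, h⟩
        exacts [rfl, absurd (hge.trans h.symm) n2,
          absurd (L.eq_of_fst_eq hf hg (h.trans hge.symm)) hfne]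
      · refine ⟨g, ⟨Or.inr ⟨hg, hgp⟩, hge⟩, ?_⟩
        rintro f ⟨(rfl | rfl) | ⟨hf, hfne⟩, h⟩
        exacts [absurd (L.eq_of_fst_eq hg hpq (hge.trans h.symm)) hgp,
          absurd h.symm (hr2 e he hne), L.eq_of_fst_eq hf hg (h.trans hge.symm)]
  prev := by
    obtain ⟨n1, n2, n3⟩ := nontrivial_of_notMem_segment h1 h2
    have hr : ∀ g ∈ L.edges, g ≠ (p, q) → r ∉ edgeSegment g := fun g hg hne hr => by
      rcases hsep g hg hne ⟨Or.inl (right_mem_segment ℝ p r), hr⟩ with h | h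
      exacts [n2 h.symm, n3 h]
    have hr1 : ∀ g ∈ L.edges, g ≠ (p, q) → g.1 ≠ r := fun g hg hne h =>
      hr g hg hne (h ▸ left_mem_segment ℝ g.1 g.2)
    have hr2 : ∀ g ∈ L.edges, g ≠ (p, q) → g.2 ≠ r := fun g hg hne h =>
      hr g hg hne (h ▸ right_mem_segment ℝ g.1 g.2)
    rintro e ((rfl | rfl) | ⟨he, hne⟩)
    · obtain ⟨g, ⟨hg, hgp⟩, -⟩ := L.prev _ hpq
      refine ⟨g, ⟨Or.inr ⟨hg, ?_⟩, hgp⟩, ?_⟩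
      · rintro rfl; exact n1 hgp.symm
      rintro f ⟨(rfl | rfl) | ⟨hf, hfne⟩, h⟩
      exacts [absurd h.symm n2, absurd h.symm n1, L.eq_of_snd_eq hf hg (h.trans hgp.symm)]
    · refine ⟨(p, r), ⟨by simp, rfl⟩, ?_⟩
      rintro f ⟨(rfl | rfl) | ⟨hf, hfne⟩, h⟩
      exacts [rfl, absurd h.symm n3, absurd h (hr2 f hf hfne)]
    · obtain ⟨g, ⟨hg, hge⟩, -⟩ := L.prev e he
      by_cases hgp : g = (p, q)
      · subst hgp
        refine ⟨(r, q), ⟨by simp, hge⟩, ?_⟩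
        rintro f ⟨(rfl | rfl) | ⟨hf, hfne⟩, h⟩
        exacts [absurd (h.trans hge.symm) n3, rfl,
          absurd (L.eq_of_snd_eq hf hg (h.trans hge.symm)) hfne]
      · refine ⟨g, ⟨Or.inr ⟨hg, hgp⟩, hge⟩, ?_⟩
        rintro f ⟨(rfl | rfl) | ⟨hf, hfne⟩, h⟩
        exacts [absurd h.symm (hr1 e he hne),
          absurd (L.eq_of_snd_eq hg hpq (hge.trans h.symm)) hgp,
          L.eq_of_snd_eq hf hg (h.trans hge.symm)]
  embedded := by
    have hmid := segment_inter_segment_of_notMem h1 h2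
    have key : ∀ g ∈ L.edges, g ≠ (p, q) → ∀ x ∈ edgeSegment g,
        (x ∈ segment ℝ p r → x = p ∧ x ∈ ({g.1, g.2} : Set R3)) ∧
        (x ∈ segment ℝ r q → x = q ∧ x ∈ ({g.1, g.2} : Set R3)) := by
      intro g hg hne x hx
      have hend : x = p ∨ x = q → x ∈ ({g.1, g.2} : Set R3) := by
        rintro (rfl | rfl)
        · exact (L.embedded _ hpq g hg hne.symm ⟨left_mem_segment ℝ _ _, hx⟩).2
        · exact (L.embedded _ hpq g hg hne.symm ⟨right_mem_segment ℝ _ _, hx⟩).2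
      refine ⟨fun h => ?_, fun h => ?_⟩
      · rcases hsep g hg hne ⟨Or.inl h, hx⟩ with rfl | rfl
        exacts [⟨rfl, hend (Or.inl rfl)⟩, absurd h h2]
      · rcases hsep g hg hne ⟨Or.inr h, hx⟩ with rfl | rfl
        exacts [absurd h h1, ⟨rfl, hend (Or.inr rfl)⟩]
    rintro e ((rfl | rfl) | ⟨he, hne⟩) f ((rfl | rfl) | ⟨hf, hfne⟩) hef x ⟨hx1, hx2⟩
    · exact absurd rfl hef
    · have := hmid ⟨hx1, hx2⟩
      simp_all
    · obtain ⟨rfl, h⟩ := (key f hf hfne x hx2).1 hx1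
      exact ⟨by simp, h⟩
    · have := hmid ⟨hx2, hx1⟩
      simp_all
    · exact absurd rfl hef
    · obtain ⟨rfl, h⟩ := (key f hf hfne x hx2).2 hx1
      exact ⟨by simp, h⟩
    · obtain ⟨rfl, h⟩ := (key e he hne x hx1).1 hx2
      exact ⟨h, by simp⟩
    · obtain ⟨rfl, h⟩ := (key e he hne x hx1).2 hx2
      exact ⟨h, by simp⟩
    · exact L.embedded e he f hf hef ⟨hx1, hx2⟩

/-- Replace two consecutive edges `(p, r)` and `(r, q)` by the edge `(p, q)`. -/
def mergeEdges (L : OrientedLink) {p q r : R3} (hpr : (p, r) ∈ L.edges) (hrq : (r, q) ∈ L.edges)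
    (hne : p ≠ q)
    (hsep : ∀ g ∈ L.edges, g ≠ (p, r) → g ≠ (r, q) →
      segment ℝ p q ∩ edgeSegment g ⊆ {p, q}) : OrientedLink where
  edges := {(p, q)} ∪ (L.edges \ {(p, r), (r, q)})
  finite := (Set.toFinite _).union (L.finite.subset Set.sdiff_subset)
  nonempty := ⟨(p, q), by simp⟩
  nondegenerate := by
    rintro e (rfl | he)
    exacts [hne, L.nondegenerate e he.1]
  next := by
    rintro e (rfl | ⟨he, hen⟩)
    · obtain ⟨g, ⟨hg, hgq⟩, -⟩ := L.next _ hrq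
      refine ⟨g, ⟨Or.inr ⟨hg, ?_⟩, hgq⟩, ?_⟩
      · rintro (rfl | rfl)
        exacts [hne hgq, L.nondegenerate _ hrq hgq]
      rintro f ⟨rfl | ⟨hf, hfne⟩, h⟩
      exacts [absurd h hne, L.eq_of_fst_eq hf hg (h.trans hgq.symm)]
    · obtain ⟨g, ⟨hg, hge⟩, -⟩ := L.next e he
      by_cases hg1 : g = (p, r)
      · subst hg1
        refine ⟨(p, q), ⟨by simp, hge⟩, ?_⟩
        rintro f ⟨rfl | ⟨hf, hfne⟩, h⟩
        exacts [rfl, absurd (Or.inl (L.eq_of_fst_eq hf hg (h.trans hge.symm))) hfne]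
      by_cases hg2 : g = (r, q)
      · subst hg2
        exact absurd (Or.inl (L.eq_of_snd_eq he hpr hge.symm)) hen
      refine ⟨g, ⟨Or.inr ⟨hg, by simp [hg1, hg2]⟩, hge⟩, ?_⟩
      rintro f ⟨rfl | ⟨hf, hfne⟩, h⟩
      exacts [absurd (L.eq_of_fst_eq hg hpr (hge.trans h.symm)) hg1,
        L.eq_of_fst_eq hf hg (h.trans hge.symm)]
  prev := by
    rintro e (rfl | ⟨he, hen⟩)
    · obtain ⟨g, ⟨hg, hgp⟩, -⟩ := L.prev _ hpr
      refine ⟨g, ⟨Or.inr ⟨hg, ?_⟩, hgp⟩, ?_⟩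
      · rintro (rfl | rfl)
        exacts [L.nondegenerate _ hpr hgp.symm, hne hgp.symm]
      rintro f ⟨rfl | ⟨hf, hfne⟩, h⟩
      exacts [absurd h.symm hne, L.eq_of_snd_eq hf hg (h.trans hgp.symm)]
    · obtain ⟨g, ⟨hg, hge⟩, -⟩ := L.prev e he
      by_cases hg1 : g = (r, q)
      · subst hg1
        refine ⟨(p, q), ⟨by simp, hge⟩, ?_⟩
        rintro f ⟨rfl | ⟨hf, hfne⟩, h⟩
        exacts [rfl, absurd (Or.inr (L.eq_of_snd_eq hf hg (h.trans hge.symm))) hfne]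
      by_cases hg2 : g = (p, r)
      · subst hg2
        exact absurd (Or.inr (L.eq_of_fst_eq he hrq hge.symm)) hen
      refine ⟨g, ⟨Or.inr ⟨hg, by simp [hg1, hg2]⟩, hge⟩, ?_⟩
      rintro f ⟨rfl | ⟨hf, hfne⟩, h⟩
      exacts [absurd (L.eq_of_snd_eq hg hrq (hge.trans h.symm)) hg1,
        L.eq_of_snd_eq hf hg (h.trans hge.symm)]
  embedded := by
    have key : ∀ g ∈ L.edges, g ∉ ({(p, r), (r, q)} : Set (R3 × R3)) → ∀ x ∈ edgeSegment g,
        x ∈ segment ℝ p q → x ∈ ({p, q} : Set R3) ∧ x ∈ ({g.1, g.2} : Set R3) := by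
      intro g hg hgn x hx hx'
      simp only [Set.mem_insert_iff, Set.mem_singleton_iff, not_or] at hgn
      have := hsep g hg hgn.1 hgn.2 ⟨hx', hx⟩
      refine ⟨this, ?_⟩
      rcases this with rfl | rfl
      · exact (L.embedded _ hpr g hg (Ne.symm hgn.1) ⟨left_mem_segment ℝ _ _, hx⟩).2
      · exact (L.embedded _ hrq g hg (Ne.symm hgn.2) ⟨right_mem_segment ℝ _ _, hx⟩).2
    rintro e (rfl | ⟨he, hen⟩) f (rfl | ⟨hf, hfn⟩) hef x ⟨hx1, hx2⟩
    · exact absurd rfl hef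
    · exact key f hf hfn x hx2 hx1
    · exact (key e he hen x hx1 hx2).symm
    · exact L.embedded e he f hf hef ⟨hx1, hx2⟩

end OrientedLink

/-! ### Small vertex displacements as ambient isotopies. -/

theorem segment_eq_lineMap_image (a b : R3) :
    segment ℝ a b = AffineMap.lineMap a b '' Set.Icc (0 : ℝ) 1 :=
  segment_eq_image_lineMap ℝ a b

/-- Two segments that start at the same point and do not overlap diverge linearly. -/
theorem exists_pos_mul_add_le_norm_smul_sub_smul {u w : R3} (hu : u ≠ 0)
    (hw : w ≠ 0) (h : ∀ a b : ℝ, 0 ≤ a → 0 ≤ b → a ≤ 1 → b ≤ 1 → a • u = b • w → a • u = 0) :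
    ∃ c : ℝ, 0 < c ∧ ∀ a b : ℝ, 0 ≤ a → 0 ≤ b → c * (a + b) ≤ ‖a • u - b • w‖ := by
  have hcont : Continuous fun s : ℝ => ‖s • u - (1 - s) • w‖ := by fun_prop
  -- Both sides are homogeneous, so the case `a + b = 1` suffices; there compactness gives a
  -- minimum, which is positive because the segments do not overlap.
  obtain ⟨s, ⟨hs0, hs1⟩, hmin⟩ :=
    isCompact_Icc.exists_isMinOn (Set.nonempty_Icc.2 zero_le_one) hcont.continuousOn
  refine ⟨‖s • u - (1 - s) • w‖, ?_, fun a b ha hb => ?_⟩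
  · rw [norm_pos_iff]
    intro h0
    have h1 := sub_eq_zero.1 h0
    have h2 := h s (1 - s) hs0 (by linarith) hs1 (by linarith) h1
    rw [h2] at h1
    have h3 : s = 0 := by simpa [hu] using h2
    rw [h3] at h1
    simp at h1
    exact hw h1.symm
  · rcases (add_nonneg ha hb).eq_or_lt with h0 | h0
    · rw [← h0, mul_zero]; exact norm_nonneg _
    have hmem : a / (a + b) ∈ Set.Icc (0 : ℝ) 1 :=
      ⟨by positivity, (div_le_one h0).2 (by linarith)⟩
    have h1 : ‖s • u - (1 - s) • w‖ ≤ ‖(a / (a + b)) • u - (1 - a / (a + b)) • w‖ := hmin hmem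
    calc _ ≤ ‖(a / (a + b)) • u - (1 - a / (a + b)) • w‖ * (a + b) := by gcongr
      _ = ‖(a + b) • ((a / (a + b)) • u - (1 - a / (a + b)) • w)‖ := by
        rw [norm_smul, Real.norm_of_nonneg h0.le, mul_comm]
      _ = _ := by
        rw [smul_sub, smul_smul, smul_smul]
        congr 3 <;> field_simp
        ring

namespace OrientedLink

/-- `f` is affine on each edge of the link `L`. -/
def IsPiecewiseAffine (L : OrientedLink) (f : R3 → ℝ) : Prop :=
  ∀ e ∈ L.edges, ∀ s ∈ Set.Icc (0 : ℝ) 1,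
    f (AffineMap.lineMap e.1 e.2 s) = AffineMap.lineMap (f e.1) (f e.2) s

/-- For points with parameters `s` and `t` on the two edges, the distance is at least a constant
times `s + t`, while `f` differs by at most a constant times `s + t`. -/
theorem lipschitz_pair_of_common_vertex {f : R3 → ℝ} {v a b : R3} (hav : a ≠ v) (hbv : b ≠ v)
    (hinter : segment ℝ v a ∩ segment ℝ v b ⊆ {v})
    (ha : ∀ s ∈ Set.Icc (0 : ℝ) 1, f (AffineMap.lineMap v a s) = AffineMap.lineMap (f v) (f a) s)
    (hb : ∀ s ∈ Set.Icc (0 : ℝ) 1, f (AffineMap.lineMap v b s) = AffineMap.lineMap (f v) (f b) s) :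
    ∃ K : ℝ, ∀ x ∈ segment ℝ v a, ∀ y ∈ segment ℝ v b, |f x - f y| ≤ K * ‖x - y‖ := by
  obtain ⟨c, hc, h⟩ := exists_pos_mul_add_le_norm_smul_sub_smul (sub_ne_zero.2 hav)
    (sub_ne_zero.2 hbv) (fun s t hs ht hs1 ht1 hst => by
      have : v + s • (a - v) ∈ segment ℝ v a ∩ segment ℝ v b := by
        constructor
        · rw [segment_eq_image']; exact ⟨s, ⟨hs, hs1⟩, rfl⟩
        · rw [segment_eq_image', hst]; exact ⟨t, ⟨ht, ht1⟩, rfl⟩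
      simpa using hinter this)
  refine ⟨(|f a - f v| + |f b - f v|) / c, ?_⟩
  rw [segment_eq_lineMap_image, segment_eq_lineMap_image]
  rintro _ ⟨s, hs, rfl⟩ _ ⟨t, ht, rfl⟩
  rw [ha s hs, hb t ht]
  have h1 := h s t hs.1 ht.1
  have h2 : (AffineMap.lineMap v a s - AffineMap.lineMap v b t : R3)
      = s • (a - v) - t • (b - v) := by
    simp only [AffineMap.lineMap_apply_module']; abel
  rw [h2, div_mul_eq_mul_div, le_div_iff₀ hc]
  simp only [AffineMap.lineMap_apply_module', smul_eq_mul]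
  have h3 : |s * (f a - f v) + f v - (t * (f b - f v) + f v)|
      ≤ s * |f a - f v| + t * |f b - f v| := by
    have : s * (f a - f v) + f v - (t * (f b - f v) + f v)
      = s * (f a - f v) - t * (f b - f v) := by ring
    rw [this]
    refine (abs_sub _ _).trans ?_
    rw [abs_mul, abs_mul, abs_of_nonneg hs.1, abs_of_nonneg ht.1]
  have hA := abs_nonneg (f a - f v)
  have hB := abs_nonneg (f b - f v)
  calc _ ≤ (s * |f a - f v| + t * |f b - f v|) * c := by gcongr
    _ ≤ (|f a - f v| + |f b - f v|) * (c * (s + t)) := by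
      have hs0 := hs.1
      have ht0 := ht.1
      nlinarith [mul_nonneg hc.le (mul_nonneg ht0 hA), mul_nonneg hc.le (mul_nonneg hs0 hB)]
    _ ≤ _ := by gcongr

theorem lineMap_reverse {f : R3 → ℝ} {a b : R3}
    (h : ∀ s ∈ Set.Icc (0 : ℝ) 1, f (AffineMap.lineMap a b s) = AffineMap.lineMap (f a) (f b) s) :
    ∀ s ∈ Set.Icc (0 : ℝ) 1, f (AffineMap.lineMap b a s) = AffineMap.lineMap (f b) (f a) s := by
  intro s hs
  rw [← AffineMap.lineMap_apply_one_sub, ← AffineMap.lineMap_apply_one_sub (f a)]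
  exact h (1 - s) ⟨by linarith [hs.2], by linarith [hs.1]⟩

/-- There are three cases. On a single edge `f` is affine. Disjoint edges have positive distance and
`f` is bounded on them. Edges that meet do so in one common vertex, where they diverge linearly. -/
theorem IsPiecewiseAffine.lipschitz_pair {L : OrientedLink} {f : R3 → ℝ}
    (hf : L.IsPiecewiseAffine f) {e g : R3 × R3} (he : e ∈ L.edges) (hg : g ∈ L.edges) :
    ∃ K : ℝ, ∀ x ∈ edgeSegment e, ∀ y ∈ edgeSegment g, |f x - f y| ≤ K * ‖x - y‖ := by
  by_cases heg : e = g
  · subst heg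
    have hne : 0 < ‖e.2 - e.1‖ := norm_pos_iff.2 (sub_ne_zero.2 (L.nondegenerate e he).symm)
    refine ⟨|f e.2 - f e.1| / ‖e.2 - e.1‖, ?_⟩
    unfold edgeSegment
    rw [segment_eq_lineMap_image]
    rintro _ ⟨s, hs, rfl⟩ _ ⟨t, ht, rfl⟩
    rw [hf e he s hs, hf e he t ht]
    have h2 : (AffineMap.lineMap e.1 e.2 s - AffineMap.lineMap e.1 e.2 t : R3)
        = (s - t) • (e.2 - e.1) := by
      simp only [AffineMap.lineMap_apply_module', sub_smul]; abel
    rw [h2, norm_smul, Real.norm_eq_abs, div_mul_eq_mul_div, le_div_iff₀ hne]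
    simp only [AffineMap.lineMap_apply_module', smul_eq_mul]
    have : s * (f e.2 - f e.1) + f e.1 - (t * (f e.2 - f e.1) + f e.1)
      = (s - t) * (f e.2 - f e.1) := by ring
    rw [this, abs_mul]
    apply le_of_eq; ring
  have hemb := L.embedded e he g hg heg
  by_cases hdisj : Disjoint (edgeSegment e) (edgeSegment g)
  · have hcomp : ∀ e : R3 × R3, IsCompact (edgeSegment e) := fun e => by
      unfold edgeSegment
      rw [segment_eq_lineMap_image]
      exact isCompact_Icc.image AffineMap.lineMap_continuous
    obtain ⟨r, hr, hr'⟩ := hdisj.exists_thickenings (hcomp e) (hcomp g).isClosed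
    have hdist : ∀ x ∈ edgeSegment e, ∀ y ∈ edgeSegment g, r ≤ ‖x - y‖ := by
      intro x hx y hy
      by_contra! hlt
      refine Set.disjoint_left.1 hr' (Metric.mem_thickening_iff.2 ⟨x, hx, ?_⟩)
        (Metric.self_subset_thickening hr _ hy)
      rwa [dist_comm, dist_eq_norm]
    have hbound : ∀ e ∈ L.edges, ∀ x ∈ edgeSegment e, |f x| ≤ |f e.1| + |f e.2| := by
      intro e he
      unfold edgeSegment
      rw [segment_eq_lineMap_image]
      rintro _ ⟨s, hs, rfl⟩
      rw [hf e he s hs, AffineMap.lineMap_apply_module, smul_eq_mul, smul_eq_mul]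
      refine (abs_add_le _ _).trans ?_
      rw [abs_mul, abs_mul, abs_of_nonneg hs.1, abs_of_nonneg (sub_nonneg.2 hs.2)]
      have := abs_nonneg (f e.1)
      have := abs_nonneg (f e.2)
      have := hs.1
      have := hs.2
      gcongr
      · nlinarith
      · nlinarith
    refine ⟨(|f e.1| + |f e.2| + (|f g.1| + |f g.2|)) / r, fun x hx y hy => ?_⟩
    rw [div_mul_eq_mul_div, le_div_iff₀ hr]
    calc _ ≤ (|f x| + |f y|) * r := by gcongr; exact abs_sub _ _
      _ ≤ _ := by
        gcongr
        exacts [hbound e he x hx, hbound g hg y hy, hdist x hx y hy]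
  · obtain ⟨v, hve, hvg⟩ := Set.not_disjoint_iff.1 hdisj
    obtain ⟨hv1, hv2⟩ := hemb ⟨hve, hvg⟩
    have hend : ∀ e ∈ L.edges, v ∈ ({e.1, e.2} : Set R3) → ∃ a, a ≠ v ∧
        edgeSegment e = segment ℝ v a ∧ ({e.1, e.2} : Set R3) = {v, a} ∧
        ∀ s ∈ Set.Icc (0 : ℝ) 1,
          f (AffineMap.lineMap v a s) = AffineMap.lineMap (f v) (f a) s := by
      rintro ⟨p, q⟩ he (hv | hv)
      · have hv : v = p := hv
        subst hv
        exact ⟨q, (L.nondegenerate _ he).symm, rfl, rfl, hf _ he⟩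
      · have hv : v = q := hv
        subst hv
        exact ⟨p, L.nondegenerate _ he, segment_symm _ _ _, Set.pair_comm _ _,
          lineMap_reverse (hf _ he)⟩
    obtain ⟨a, hav, hea, hea', hfa⟩ := hend e he hv1
    obtain ⟨b, hbv, hgb, hgb', hfb⟩ := hend g hg hv2
    rw [hea, hgb, hea', hgb'] at hemb
    rw [hea, hgb]
    refine lipschitz_pair_of_common_vertex hav hbv (fun x hx => ?_) hfa hfb
    obtain ⟨h1, h2⟩ := hemb hx
    by_contra hxv
    obtain rfl : x = a := by simpa [show x ≠ v from hxv] using h1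
    obtain rfl : x = b := by simpa [show x ≠ v from hxv] using h2
    -- Sharing both endpoints would make the two segments equal, and their midpoint is a common
    -- point that is not an endpoint.
    have hm := midpoint_mem_segment (𝕜 := ℝ) v x
    rcases (hemb ⟨hm, hm⟩).1 with h | h
    · exact hav (midpoint_eq_left_iff ℝ |>.1 h).symm
    · exact hav (midpoint_eq_right_iff ℝ |>.1 h).symm

/-- Finitely many pairs of edges give one Lipschitz constant on the support, and a real-valued
Lipschitz function extends to the whole space. -/
theorem IsPiecewiseAffine.exists_lipschitz {L : OrientedLink} {f : R3 → ℝ}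
    (hf : L.IsPiecewiseAffine f) : ∃ (K : NNReal) (g : R3 → ℝ), LipschitzWith K g ∧
      ∀ x ∈ L.support, g x = f x := by
  have hpair : ∀ P : L.edges × L.edges, ∃ K : ℝ, ∀ x ∈ edgeSegment P.1.1,
      ∀ y ∈ edgeSegment P.2.1, |f x - f y| ≤ K * ‖x - y‖ :=
    fun P => hf.lipschitz_pair P.1.2 P.2.2
  choose K hK using hpair
  have : Finite L.edges := L.finite
  obtain ⟨B, hB⟩ := (Set.finite_range K).bddAbove
  have hlip : LipschitzOnWith (Real.toNNReal B) f L.support := by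
    refine LipschitzOnWith.of_dist_le_mul fun x hx y hy => ?_
    simp only [support, Set.mem_iUnion] at hx hy
    obtain ⟨e, he, hx⟩ := hx
    obtain ⟨g, hg, hy⟩ := hy
    rw [Real.dist_eq, dist_eq_norm]
    refine (hK (⟨e, he⟩, ⟨g, hg⟩) x hx y hy).trans ?_
    gcongr
    exact (hB ⟨_, rfl⟩).trans (Real.le_coe_toNNReal B)
  obtain ⟨g, hg, hgf⟩ := hlip.extend_real
  exact ⟨_, g, hg, fun x hx => (hgf hx).symm⟩

end OrientedLink

/-- The perturbation of the identity has Lipschitz constant at most `K * ‖w‖ < 1`, so the global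
form of the inverse function theorem for `ApproximatesLinearOn` applies. -/
theorem isHomeomorph_add_smul {g : R3 → ℝ} {K : NNReal} (hg : LipschitzWith K g) {w : R3}
    (hw : K * ‖w‖₊ < 1) : IsHomeomorph fun x => x + g x • w := by
  have happ : ApproximatesLinearOn (fun x => x + g x • w)
      ((ContinuousLinearEquiv.refl ℝ R3 : R3 ≃L[ℝ] R3) : R3 →L[ℝ] R3) Set.univ (K * ‖w‖₊) := by
    intro x _ y _
    have : x + g x • w - (y + g y • w) -
        ((ContinuousLinearEquiv.refl ℝ R3 : R3 ≃L[ℝ] R3) : R3 →L[ℝ] R3) (x - y)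
        = (g x - g y) • w := by
      simp [sub_smul]
      abel
    rw [this, norm_smul, NNReal.coe_mul, coe_nnnorm]
    have h := hg.dist_le_mul x y
    rw [Real.dist_eq, dist_eq_norm] at h
    rw [Real.norm_eq_abs]
    calc _ ≤ (K * ‖x - y‖) * ‖w‖ := by gcongr
      _ = _ := by ring
  have hc : K * ‖w‖₊ <
      ‖((ContinuousLinearEquiv.refl ℝ R3 : R3 ≃L[ℝ] R3).symm : R3 →L[ℝ] R3)‖₊⁻¹ := by
    have : ‖((ContinuousLinearEquiv.refl ℝ R3 : R3 ≃L[ℝ] R3).symm : R3 →L[ℝ] R3)‖₊ = 1 := by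
      exact NNReal.eq (ContinuousLinearMap.norm_id (𝕜 := ℝ) (E := R3))
    rw [this, inv_one]
    exact hw
  exact (happ.toHomeomorph _ (Or.inr hc)).isHomeomorph

theorem image_segment_of_affine {φ : R3 → R3} {a b : R3}
    (h : ∀ s ∈ Set.Icc (0 : ℝ) 1,
      φ (AffineMap.lineMap a b s) = AffineMap.lineMap (φ a) (φ b) s) :
    φ '' edgeSegment (a, b) = edgeSegment (φ a, φ b) := by
  unfold edgeSegment
  rw [segment_eq_lineMap_image, segment_eq_lineMap_image, Set.image_image]
  exact Set.image_congr h

namespace OrientedLink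

/-- The piecewise affine function on a link that is `1` at a vertex and `0` at all others. -/
theorem exists_hat (L : OrientedLink) {p m q : R3} (hpm : (p, m) ∈ L.edges)
    (hmq : (m, q) ∈ L.edges) : ∃ f : R3 → ℝ, L.IsPiecewiseAffine f ∧ f m = 1 ∧ f p = 0 ∧ f q = 0 ∧
      ∀ g ∈ L.edges, g ≠ (p, m) → g ≠ (m, q) → ∀ x ∈ edgeSegment g, f x = 0 := by
  classical
  have hpm0 : ‖m - p‖ ≠ 0 := norm_ne_zero_iff.2 (sub_ne_zero.2 (L.nondegenerate _ hpm).symm)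
  have hmq0 : ‖m - q‖ ≠ 0 := norm_ne_zero_iff.2 (sub_ne_zero.2 (L.nondegenerate _ hmq))
  have hne : (p, m) ≠ (m, q) := fun h => L.nondegenerate _ hpm (congrArg Prod.fst h)
  set f : R3 → ℝ := fun x => if x ∈ segment ℝ p m then ‖x - p‖ / ‖m - p‖ else
    if x ∈ segment ℝ m q then ‖x - q‖ / ‖m - q‖ else 0 with hf
  have hfst : ∀ s ∈ Set.Icc (0 : ℝ) 1, f (AffineMap.lineMap p m s) = s := by
    intro s hs
    have hmem : AffineMap.lineMap p m s ∈ segment ℝ p m := by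
      rw [segment_eq_lineMap_image]; exact ⟨s, hs, rfl⟩
    have h1 : AffineMap.lineMap p m s - p = s • (m - p) := by
      simp [AffineMap.lineMap_apply_module']
    simp only [hf, if_pos hmem, h1, norm_smul, Real.norm_of_nonneg hs.1]
    field_simp
  have hm : f m = 1 := by simpa using hfst 1 (by simp)
  have hp : f p = 0 := by simpa using hfst 0 (by simp)
  have hsnd : ∀ s ∈ Set.Icc (0 : ℝ) 1, f (AffineMap.lineMap m q s) = 1 - s := by
    intro s hs
    have hmem : AffineMap.lineMap m q s ∈ segment ℝ m q := by
      rw [segment_eq_lineMap_image]; exact ⟨s, hs, rfl⟩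
    have h1 : AffineMap.lineMap m q s - q = (1 - s) • (m - q) := by
      simp only [AffineMap.lineMap_apply_module']; module
    -- Where both branches of `f` could apply, the first one wins. By embeddedness this happens only
    -- at `m`, where both give 1; `p = q` is impossible, as the two edges would be the same segment.
    by_cases hx : AffineMap.lineMap m q s ∈ segment ℝ p m
    · have h2 := L.embedded _ hpm _ hmq hne ⟨hx, hmem⟩
      have h3 : AffineMap.lineMap m q s = m := by
        obtain ⟨h4 | h4, h5 | h5⟩ := h2
        · exact h5
        · rw [h4] at h5
          have h5 : p = q := h5
          subst h5
          have hmid := midpoint_mem_segment (𝕜 := ℝ) p m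
          rcases (L.embedded _ hpm _ hmq hne ⟨hmid, by
            unfold edgeSegment; rw [segment_symm]; exact hmid⟩).1 with h | h
          · exact absurd ((midpoint_eq_left_iff ℝ).1 h) (L.nondegenerate _ hpm)
          · exact absurd ((midpoint_eq_right_iff ℝ).1 h) (L.nondegenerate _ hpm)
        · exact h4
        · exact h4
      rw [h3, hm]
      rw [h3, ← neg_sub, ← sub_eq_zero] at h1
      have h6 : s • (m - q) = 0 := by
        rw [← h1]; module
      have : s = 0 := by
        rcases smul_eq_zero.1 h6 with h | h
        · exact h
        · exact absurd (by rw [h, norm_zero]) hmq0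
      rw [this, sub_zero]
    · simp only [hf, if_neg hx, if_pos hmem, h1, norm_smul,
        Real.norm_of_nonneg (sub_nonneg.2 hs.2)]
      field_simp
  have hq : f q = 0 := by simpa using hsnd 1 (by simp)
  have hother : ∀ g ∈ L.edges, g ≠ (p, m) → g ≠ (m, q) → ∀ x ∈ edgeSegment g, f x = 0 := by
    intro g hg h1 h2 x hx
    have hxm : x ∈ ({g.1, g.2} : Set R3) → x ≠ m := by
      rintro (h | h) rfl
      · exact h2 (L.eq_of_fst_eq hg hmq h.symm)
      · exact h1 (L.eq_of_snd_eq hg hpm h.symm)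
    by_cases hx1 : x ∈ segment ℝ p m
    · obtain ⟨h3 | h3, h4⟩ := L.embedded _ hpm g hg h1.symm ⟨hx1, hx⟩
      · rw [h3]; exact hp
      · exact absurd h3 (hxm h4)
    by_cases hx2 : x ∈ segment ℝ m q
    · obtain ⟨h3 | h3, h4⟩ := L.embedded _ hmq g hg h2.symm ⟨hx2, hx⟩
      · exact absurd h3 (hxm h4)
      · rw [h3]; exact hq
    simp only [hf, if_neg hx1, if_neg hx2]
  refine ⟨f, ?_, hm, hp, hq, hother⟩
  intro e he s hs
  by_cases h1 : e = (p, m)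
  · subst h1
    simp only [hfst s hs, hp, hm]
    simp [AffineMap.lineMap_apply_module']
  by_cases h2 : e = (m, q)
  · subst h2
    simp only [hsnd s hs, hq, hm]
    simp [AffineMap.lineMap_apply_module']
    ring
  have h3 := hother e he h1 h2
  rw [h3 e.1 (left_mem_segment ℝ _ _), h3 e.2 (right_mem_segment ℝ _ _),
    h3 _ (by unfold edgeSegment; rw [segment_eq_lineMap_image]; exact ⟨s, hs, rfl⟩)]
  simp

theorem edgeSegment_subset_support (L : OrientedLink) {e : R3 × R3} (he : e ∈ L.edges) :
    edgeSegment e ⊆ L.support := Set.subset_biUnion_of_mem (u := edgeSegment) he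

/-- Moving a vertex of a link slightly does not change the isotopy class. -/
theorem exists_isotopic_move_vertex (L : OrientedLink) {p m q : R3} (hpm : (p, m) ∈ L.edges)
    (hmq : (m, q) ∈ L.edges) : ∃ ε : ℝ, 0 < ε ∧ ∀ w : R3, ‖w‖ < ε → ∃ M : OrientedLink,
      M.edges = {(p, m + w), (m + w, q)} ∪ (L.edges \ {(p, m), (m, q)}) ∧ L.Isotopic M := by
  obtain ⟨f, hf, hfm, hfp, hfq, hf0⟩ := L.exists_hat hpm hmq
  obtain ⟨K, g, hg, hgf⟩ := hf.exists_lipschitz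
  -- This bound ensures `K * ‖w‖ < 1`; the `+ 1` avoids a division by zero.
  refine ⟨1 / (K + 1), by positivity, fun w hw => ?_⟩
  rw [lt_div_iff₀ (by positivity)] at hw
  have hKw : K * ‖w‖₊ < 1 := by
    rw [← NNReal.coe_lt_coe, NNReal.coe_mul, coe_nnnorm, NNReal.coe_one]
    nlinarith [norm_nonneg w]
  -- Every point is pushed in the direction `w`, in proportion to the extended hat function. Since
  -- that function is affine on each edge, edges stay straight.
  set H : unitInterval × R3 → R3 := fun P => P.2 + g P.2 • ((P.1 : ℝ) • w) with hH
  have hiso : IsAmbientIsotopy H := by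
    refine ⟨?_, fun t =>
      isHomeomorph_add_smul (w := (t : ℝ) • w) hg (lt_of_le_of_lt ?_ hKw), fun x => by simp [hH]⟩
    · have := hg.continuous
      fun_prop
    · rw [nnnorm_smul]
      gcongr
      refine mul_le_of_le_one_left (by positivity) ?_
      rw [← NNReal.coe_le_coe, coe_nnnorm, Real.norm_of_nonneg t.2.1]
      exact t.2.2
  have hgaff : ∀ e ∈ L.edges, ∀ s ∈ Set.Icc (0 : ℝ) 1,
      g (AffineMap.lineMap e.1 e.2 s) = AffineMap.lineMap (g e.1) (g e.2) s := by
    intro e he s hs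
    have hsub := L.edgeSegment_subset_support he
    rw [hgf _ (hsub (left_mem_segment ℝ _ _)), hgf _ (hsub (right_mem_segment ℝ _ _)), hgf,
      hf e he s hs]
    apply hsub
    unfold edgeSegment
    rw [segment_eq_lineMap_image]
    exact ⟨s, hs, rfl⟩
  have hseg : ∀ e ∈ L.edges,
      (fun p => H (1, p)) '' edgeSegment e = edgeSegment (H (1, e.1), H (1, e.2)) := by
    intro e he
    refine image_segment_of_affine (φ := fun p => H (1, p)) fun s hs => ?_
    simp only [hH, hgaff e he s hs]
    simp only [AffineMap.lineMap_apply_module', smul_eq_mul]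
    module
  refine ⟨_, ?_, L.isotopic_image hiso hseg⟩
  have hgm : g m = 1 := by
    rw [hgf _ (L.edgeSegment_subset_support hpm (right_mem_segment ℝ _ _)), hfm]
  have hgp : g p = 0 := by
    rw [hgf _ (L.edgeSegment_subset_support hpm (left_mem_segment ℝ _ _)), hfp]
  have hgq : g q = 0 := by
    rw [hgf _ (L.edgeSegment_subset_support hmq (right_mem_segment ℝ _ _)), hfq]
  have hg0 : ∀ e ∈ L.edges \ {(p, m), (m, q)}, (H (1, e.1), H (1, e.2)) = e := by
    rintro e ⟨he, hen⟩
    simp only [Set.mem_insert_iff, Set.mem_singleton_iff, not_or] at hen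
    have hsub := L.edgeSegment_subset_support he
    have h1 : g e.1 = 0 := by
      rw [hgf _ (hsub (left_mem_segment ℝ _ _)), hf0 e he hen.1 hen.2 _ (left_mem_segment ℝ _ _)]
    have h2 : g e.2 = 0 := by
      rw [hgf _ (hsub (right_mem_segment ℝ _ _)), hf0 e he hen.1 hen.2 _ (right_mem_segment ℝ _ _)]
    simp [hH, h1, h2]
  have hsplit : L.edges = {(p, m), (m, q)} ∪ (L.edges \ {(p, m), (m, q)}) := by
    rw [Set.union_sdiff_cancel]
    rintro e (rfl | rfl)
    exacts [hpm, hmq]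
  change (fun e : R3 × R3 => (H (1, e.1), H (1, e.2))) '' L.edges = _
  conv_lhs => rw [hsplit]
  rw [Set.image_union, Set.image_pair]
  congr 1
  · simp [hH, hgm, hgp, hgq]
  · rw [Set.image_congr hg0, Set.image_id']

end OrientedLink

/-! ### Triangle moves. -/

namespace OrientedLink

theorem segment_union_subset_convexHull {p q r x : R3} (hx : x ∈ convexHull ℝ {p, q, r}) :
    segment ℝ p x ∪ segment ℝ x q ⊆ convexHull ℝ {p, q, r} := by
  have hc := convex_convexHull ℝ ({p, q, r} : Set R3)
  have hp : p ∈ convexHull ℝ ({p, q, r} : Set R3) := subset_convexHull _ _ (by simp)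
  have hq : q ∈ convexHull ℝ ({p, q, r} : Set R3) := subset_convexHull _ _ (by simp)
  exact Set.union_subset (hc.segment_subset hp hx) (hc.segment_subset hx hq)

/-- If `p` lay on the segment from a point of the median to `q`, the equation expressing this could
be solved for `p`, whose coefficient `c` is at least `1/2`, and would exhibit `p` as a convex
combination of `r` and `q`. -/
theorem notMem_segment_lineMap_midpoint {p q r : R3} (h : p ∉ segment ℝ r q) {s : ℝ}
    (hs : s ∈ Set.Icc (0 : ℝ) 1) :
    p ∉ segment ℝ (AffineMap.lineMap (midpoint ℝ p q) r s) q := by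
  rw [segment_eq_image]
  rintro ⟨t, ⟨ht0, ht1⟩, ht⟩
  obtain ⟨hs0, hs1⟩ := hs
  simp only [AffineMap.lineMap_apply_module, midpoint_eq_smul_add, invOf_eq_inv] at ht
  set c : ℝ := 1 - (1 - t) * (1 - s) / 2 with hc
  have hc0 : 0 < c := by nlinarith
  have hx : c • p = ((1 - t) * s) • r + (c - (1 - t) * s) • q := by
    rw [← sub_eq_zero] at ht ⊢
    rw [← neg_eq_zero, ← ht, hc]
    module
  apply h
  rw [segment_eq_image]
  have hle : 0 ≤ c - (1 - t) * s := by nlinarith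
  refine ⟨(c - (1 - t) * s) / c, ⟨by positivity, (div_le_one hc0).2 ?_⟩, ?_⟩
  · nlinarith
  · have hp : p = c⁻¹ • (c • p) := by rw [smul_smul, inv_mul_cancel₀ hc0.ne', one_smul]
    rw [hx] at hp
    conv_rhs => rw [hp]
    rw [smul_add, smul_smul, smul_smul]
    have e1 : c⁻¹ * ((1 - t) * s) = 1 - (c - (1 - t) * s) / c := by field_simp; ring
    have e2 : c⁻¹ * (c - (1 - t) * s) = (c - (1 - t) * s) / c := by field_simp
    rw [e1, e2]

theorem segment_union_segment_midpoint (p q : R3) :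
    segment ℝ p (midpoint ℝ p q) ∪ segment ℝ (midpoint ℝ p q) q = segment ℝ p q := by
  have hm := midpoint_mem_segment (𝕜 := ℝ) p q
  refine Set.Subset.antisymm (Set.union_subset
    ((convex_segment p q).segment_subset (left_mem_segment ℝ p q) hm)
    ((convex_segment p q).segment_subset hm (right_mem_segment ℝ p q))) ?_
  rw [segment_eq_image' ℝ p q]
  rintro _ ⟨s, ⟨hs0, hs1⟩, rfl⟩
  rw [segment_eq_image', segment_eq_image']
  simp only [midpoint_eq_smul_add, invOf_eq_inv]
  rcases le_total s (1 / 2) with h | h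
  · exact Or.inl ⟨2 * s, ⟨by linarith, by linarith⟩, by module⟩
  · exact Or.inr ⟨2 * s - 1, ⟨by linarith, by linarith⟩, by module⟩

/-- A triangle move: an edge `(p, q)` may be replaced by `(p, r)` and `(r, q)` if the triangle with
the vertices `p`, `q`, `r` meets the rest of the link at most in `p` and `q`. -/
theorem exists_triangle_split {D : OrientedLink → LaurentPolynomial ℤ} (hD : IsLinkInvariant D)
    (L : OrientedLink) {p q r : R3} (hpq : (p, q) ∈ L.edges) (h1 : p ∉ segment ℝ r q)
    (h2 : q ∉ segment ℝ p r)
    (htri : ∀ g ∈ L.edges, g ≠ (p, q) → convexHull ℝ {p, q, r} ∩ edgeSegment g ⊆ {p, q}) :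
    ∃ M : OrientedLink, M.edges = {(p, r), (r, q)} ∪ (L.edges \ {(p, q)}) ∧ D M = D L := by
  -- The apex slides along the median, from the midpoint of the edge to `r`, and all intermediate
  -- polygons stay inside the triangle.
  set m : ℝ → R3 := fun s => AffineMap.lineMap (midpoint ℝ p q) r s with hm
  have hcv := convex_convexHull ℝ ({p, q, r} : Set R3)
  have hmem : ∀ s ∈ Set.Icc (0 : ℝ) 1, m s ∈ convexHull ℝ ({p, q, r} : Set R3) := fun s hs => by
    have hp : p ∈ convexHull ℝ ({p, q, r} : Set R3) := subset_convexHull _ _ (by simp)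
    have hq : q ∈ convexHull ℝ ({p, q, r} : Set R3) := subset_convexHull _ _ (by simp)
    have hr : r ∈ convexHull ℝ ({p, q, r} : Set R3) := subset_convexHull _ _ (by simp)
    refine hcv.segment_subset (hcv.segment_subset hp hq (midpoint_mem_segment p q)) hr ?_
    rw [segment_eq_lineMap_image]
    exact ⟨s, hs, rfl⟩
  have hm1 : ∀ s ∈ Set.Icc (0 : ℝ) 1, p ∉ segment ℝ (m s) q := fun s hs =>
    notMem_segment_lineMap_midpoint h1 hs
  have hm2 : ∀ s ∈ Set.Icc (0 : ℝ) 1, q ∉ segment ℝ p (m s) := fun s hs => by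
    have h := notMem_segment_lineMap_midpoint (p := q) (q := p) (r := r) (by rwa [segment_symm]) hs
    rwa [midpoint_comm, segment_symm] at h
  let F : unitInterval → OrientedLink := fun s => L.splitEdge hpq (m s) (hm1 s s.2) (hm2 s s.2)
    fun g hg hgn => (Set.inter_subset_inter_left _
      (segment_union_subset_convexHull (hmem s s.2))).trans (htri g hg hgn)
  have hFe : ∀ s : unitInterval, (F s).edges = {(p, m s), (m s, q)} ∪ (L.edges \ {(p, q)}) :=
    fun s => rfl
  have hFdiff : ∀ s : unitInterval,
      (F s).edges \ {(p, m s), (m s, q)} = L.edges \ {(p, q)} := by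
    intro s
    rw [hFe, Set.union_sdiff_left]
    refine sdiff_eq_left.2 (Set.disjoint_left.2 ?_)
    rintro e ⟨he, hen⟩ hes
    obtain ⟨n1, n2, n3⟩ := nontrivial_of_notMem_segment (hm1 s s.2) (hm2 s s.2)
    have hme : m s ∈ edgeSegment e := by
      rcases hes with rfl | rfl
      exacts [right_mem_segment ℝ _ _, left_mem_segment ℝ _ _]
    rcases htri e he hen ⟨hmem s s.2, hme⟩ with h | h
    exacts [n2 h.symm, n3 h]
  have hcont : Continuous fun s : unitInterval => m s := by
    simp only [hm]
    exact AffineMap.lineMap_continuous.comp continuous_subtype_val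
  -- Neighbouring positions of the apex differ by a small vertex displacement. So `D` is locally
  -- constant along the connected interval, and no single isotopy for the whole move is needed.
  have hloc : IsLocallyConstant fun s => D (F s) := by
    rw [IsLocallyConstant.iff_eventually_eq]
    intro s
    obtain ⟨ε, hε, h⟩ := (F s).exists_isotopic_move_vertex (p := p) (m := m s) (q := q)
      (by rw [hFe]; simp) (by rw [hFe]; simp)
    filter_upwards [Metric.continuousAt_iff'.1 hcont.continuousAt ε hε] with t ht
    rw [dist_eq_norm] at ht
    obtain ⟨M, hM, hiso⟩ := h _ ht
    rw [hFdiff, add_sub_cancel, ← hFe] at hM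
    rw [← eq_of_edges_eq hM]
    exact (hD _ _ hiso).symm
  have hconst := hloc.apply_eq_of_preconnectedSpace 1 0
  refine ⟨F 1, ?_, hconst.trans ?_⟩
  · rw [hFe]
    have : m (1 : unitInterval) = r := by simp [hm]
    rw [this]
  -- The initial position only subdivides the edge, so the identity isotopy relates it to `L`.
  · have hm0 : m (0 : unitInterval) = midpoint ℝ p q := by simp [hm]
    have hun : segment ℝ p (midpoint ℝ p q) ∪ segment ℝ (midpoint ℝ p q) q = segment ℝ p q :=
      segment_union_segment_midpoint p q
    refine hD _ _ ⟨F 0, F 0, Refines.refl _, ⟨?_, ?_⟩, fun P => P.2,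
      ⟨continuous_snd, fun _ => IsHomeomorph.id, fun _ => rfl⟩, by simp, by simp⟩
    · have hL : L.edges = {(p, q)} ∪ (L.edges \ {(p, q)}) := by
        rw [Set.union_sdiff_cancel]; simpa using hpq
      unfold support
      conv_rhs => rw [hL]
      rw [hFe, Set.biUnion_union, Set.biUnion_union, Set.biUnion_pair, Set.biUnion_singleton, hm0]
      congr 1
    · rw [hFe, hm0]
      rintro e ((rfl | rfl) | ⟨he, -⟩)
      · refine ⟨_, hpq, ?_, 1 / 2, by norm_num, ?_⟩
        · exact (Set.subset_union_left.trans hun.subset)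
        · simp only [midpoint_eq_smul_add, invOf_eq_inv]; module
      · refine ⟨_, hpq, ?_, 1 / 2, by norm_num, ?_⟩
        · exact (Set.subset_union_right.trans hun.subset)
        · simp only [midpoint_eq_smul_add, invOf_eq_inv]; module
      · exact ⟨e, he, subset_rfl, 1, one_pos, (one_smul _ _).symm⟩

/-- The inverse of a triangle move. -/
theorem exists_triangle_merge {D : OrientedLink → LaurentPolynomial ℤ} (hD : IsLinkInvariant D)
    (L : OrientedLink) {p q r : R3} (hpr : (p, r) ∈ L.edges) (hrq : (r, q) ∈ L.edges)
    (h1 : p ∉ segment ℝ r q) (h2 : q ∉ segment ℝ p r)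
    (htri : ∀ g ∈ L.edges, g ≠ (p, r) → g ≠ (r, q) →
      convexHull ℝ {p, q, r} ∩ edgeSegment g ⊆ {p, q}) :
    ∃ M : OrientedLink, M.edges = {(p, q)} ∪ (L.edges \ {(p, r), (r, q)}) ∧ D M = D L := by
  obtain ⟨n1, n2, n3⟩ := nontrivial_of_notMem_segment h1 h2
  have hsub : segment ℝ p q ⊆ convexHull ℝ ({p, q, r} : Set R3) :=
    (convex_convexHull ℝ _).segment_subset (subset_convexHull _ _ (by simp))
      (subset_convexHull _ _ (by simp))
  let M := L.mergeEdges hpr hrq n1 fun g hg hg1 hg2 =>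
    (Set.inter_subset_inter_left _ hsub).trans (htri g hg hg1 hg2)
  have hMe : M.edges = {(p, q)} ∪ (L.edges \ {(p, r), (r, q)}) := rfl
  have hold : ∀ g ∈ M.edges, g ≠ (p, q) → g ∈ L.edges ∧ g ≠ (p, r) ∧ g ≠ (r, q) := by
    rintro g (hg | ⟨hg, hgn⟩) hne
    · exact absurd hg hne
    · exact ⟨hg, by simpa using hgn⟩
  -- Splitting the merged edge again recovers `L`.
  obtain ⟨N, hN, hDN⟩ := M.exists_triangle_split hD (r := r) (Or.inl rfl) h1 h2 fun g hg hne =>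
    htri g (hold g hg hne).1 (hold g hg hne).2.1 (hold g hg hne).2.2
  refine ⟨M, hMe, ?_⟩
  rw [← hDN]
  congr 1
  apply eq_of_edges_eq
  have hnot : (p, q) ∉ L.edges := fun h => n3 (by
    simpa using congrArg Prod.snd (L.eq_of_fst_eq hpr h rfl))
  rw [hN, hMe, Set.union_sdiff_left, Set.sdiff_singleton_eq_self (fun h => hnot h.1),
    Set.union_sdiff_cancel]
  rintro e (rfl | rfl)
  exacts [hpr, hrq]

end OrientedLink

/-! ### Isolating an extreme edge. -/

theorem linear_le_of_mem_segment {ℓ : R3 →ₗ[ℝ] ℝ} {a b x : R3} {c : ℝ} (hx : x ∈ segment ℝ a b)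
    (ha : ℓ a ≤ c) (hb : ℓ b ≤ c) : ℓ x ≤ c :=
  (convex_halfSpace_le ℓ.isLinear c).segment_subset ha hb hx

theorem linear_lt_of_mem_segment {ℓ : R3 →ₗ[ℝ] ℝ} {a b x : R3} {c : ℝ} (hx : x ∈ segment ℝ a b)
    (ha : ℓ a < c) (hb : ℓ b < c) : ℓ x < c :=
  (convex_halfSpace_lt ℓ.isLinear c).segment_subset ha hb hx

theorem lt_linear_of_mem_segment {ℓ : R3 →ₗ[ℝ] ℝ} {a b x : R3} {c : ℝ} (hx : x ∈ segment ℝ a b)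
    (ha : c < ℓ a) (hb : c < ℓ b) : c < ℓ x :=
  (convex_halfSpace_gt ℓ.isLinear c).segment_subset ha hb hx

theorem eq_right_of_mem_segment {ℓ : R3 →ₗ[ℝ] ℝ} {a b x : R3} {c : ℝ} (hx : x ∈ segment ℝ a b)
    (ha : ℓ a < c) (hb : ℓ b ≤ c) (hxc : c ≤ ℓ x) : x = b := by
  rw [segment_eq_image'] at hx
  obtain ⟨s, ⟨hs0, hs1⟩, rfl⟩ := hx
  rw [map_add, map_smul, map_sub, smul_eq_mul] at hxc
  rcases hs1.eq_or_lt with rfl | hs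
  · simp
  · nlinarith

namespace OrientedLink

/-- A degenerate triangle move: the triangle is the edge itself, so embeddedness of the link is all
that is needed. -/
theorem exists_subdivide {D : OrientedLink → LaurentPolynomial ℤ} (hD : IsLinkInvariant D)
    (L : OrientedLink) {p q r : R3} (hpq : (p, q) ∈ L.edges) (hr : r ∈ segment ℝ p q)
    (hrp : r ≠ p) (hrq : r ≠ q) :
    ∃ M : OrientedLink, M.edges = {(p, r), (r, q)} ∪ (L.edges \ {(p, q)}) ∧ D M = D L := by
  have hne : p ≠ q := L.nondegenerate _ hpq
  have hr' := hr
  rw [segment_eq_image'] at hr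
  obtain ⟨s, ⟨hs0, hs1⟩, rfl⟩ := hr
  have hs0 : 0 < s := hs0.lt_of_ne (by rintro rfl; simp at hrp)
  have hs1 : s < 1 := hs1.lt_of_ne (by rintro rfl; simp at hrq)
  refine L.exists_triangle_split hD hpq ?_ ?_ fun g hg hgn => ?_
  · rw [segment_eq_image]
    rintro ⟨t, ⟨ht0, ht1⟩, ht⟩
    have h0 : ((1 - t) * s + t) • (q - p) = 0 := by
      rw [← sub_eq_zero] at ht
      rw [← ht]; module
    rcases smul_eq_zero.1 h0 with h | h
    · nlinarith
    · exact hne (sub_eq_zero.1 h).symm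
  · rw [segment_eq_image]
    rintro ⟨t, ⟨ht0, ht1⟩, ht⟩
    have h0 : (1 - t * s) • (q - p) = 0 := by
      rw [← sub_eq_zero, ← neg_eq_zero] at ht
      rw [← ht]; module
    rcases smul_eq_zero.1 h0 with h | h
    · nlinarith
    · exact hne (sub_eq_zero.1 h).symm
  · rintro x ⟨hx, hxg⟩
    refine (L.embedded _ hpq g hg hgn.symm ⟨?_, hxg⟩).1
    refine convexHull_min ?_ (convex_segment p q) hx
    rintro y (rfl | rfl | rfl)
    exacts [left_mem_segment ℝ _ _, right_mem_segment ℝ _ _, hr']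

theorem exists_mem_segment_level {ℓ : R3 →ₗ[ℝ] ℝ} {a b : R3} {c : ℝ} (ha : ℓ a < c) (hb : c < ℓ b) :
    ∃ x ∈ segment ℝ a b, ℓ x = c := by
  refine ⟨a + ((c - ℓ a) / (ℓ b - ℓ a)) • (b - a), ?_, ?_⟩
  · rw [segment_eq_image']
    refine ⟨_, ⟨?_, ?_⟩, rfl⟩
    · exact div_nonneg (by linarith) (by linarith)
    · rw [div_le_one (by linarith)]; linarith
  · rw [map_add, map_smul, map_sub, smul_eq_mul]
    have : ℓ b - ℓ a ≠ 0 := by linarith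
    field_simp
    ring

/-- If a link has components on both sides of the plane `ℓ = 0`, then, up to isotopy, `ℓ` attains
its maximum on the part with `ℓ < 0` exactly along one edge `(p, q)`. -/
theorem exists_extreme_edge {D : OrientedLink → LaurentPolynomial ℤ} (hD : IsLinkInvariant D)
    (ℓ : R3 →ₗ[ℝ] ℝ) {v : R3} (hv : ℓ v = 1) (L : OrientedLink)
    (hside : ∀ e ∈ L.edges, (ℓ e.1 < 0 ∧ ℓ e.2 < 0) ∨ (0 < ℓ e.1 ∧ 0 < ℓ e.2))
    (hneg : ∃ e ∈ L.edges, ℓ e.1 < 0) :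
    ∃ (M : OrientedLink) (p q : R3) (c : ℝ), D M = D L ∧ c < 0 ∧ (p, q) ∈ M.edges ∧ ℓ p = c ∧
      ℓ q = c ∧ (∀ e ∈ L.edges, 0 < ℓ e.1 → e ∈ M.edges) ∧
      ∀ e ∈ M.edges, e ≠ (p, q) → (e ∈ L.edges ∧ 0 < ℓ e.1 ∧ 0 < ℓ e.2) ∨
        ∀ x ∈ edgeSegment e, ℓ x ≤ c ∧ (ℓ x = c → x = p ∨ x = q) := by
  obtain ⟨⟨m, q₀⟩, ⟨hmq, hm0⟩, hmax⟩ := Set.exists_max_image {e ∈ L.edges | ℓ e.1 < 0}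
    (fun e => ℓ e.1) (L.finite.subset (Set.sep_subset _ _)) hneg
  simp only at hm0 hmax
  have hle1 : ∀ e ∈ L.edges, ℓ e.1 < 0 → ℓ e.1 ≤ ℓ m := fun e he h => hmax e ⟨he, h⟩
  have hle2 : ∀ e ∈ L.edges, ℓ e.2 < 0 → ℓ e.2 ≤ ℓ m := fun e he h => by
    obtain ⟨f, ⟨hf, hfe⟩, -⟩ := L.next e he
    rw [← hfe] at h ⊢
    exact hle1 f hf h
  obtain ⟨⟨p₀, m'⟩, ⟨hpm, hm'⟩, -⟩ := L.prev _ hmq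
  obtain rfl : m' = m := hm'
  obtain ⟨ε, hε, hmove⟩ := L.exists_isotopic_move_vertex hpm hmq
  -- A highest vertex on the negative side is lifted by `η`: little enough for an isotopy and for
  -- staying below 0, yet making it the only highest vertex there.
  obtain ⟨η, hη, hη1, hη2⟩ : ∃ η : ℝ, 0 < η ∧ η * ‖v‖ < ε ∧ ℓ m' + η < 0 := by
    refine ⟨min (ε / (‖v‖ + 1)) (-ℓ m' / 2), lt_min (by positivity) (by linarith), ?_, ?_⟩
    · refine lt_of_le_of_lt (mul_le_mul_of_nonneg_right (min_le_left _ _) (norm_nonneg v)) ?_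
      rw [div_mul_eq_mul_div, div_lt_iff₀ (by positivity)]
      nlinarith
    · have := min_le_right (ε / (‖v‖ + 1)) (-ℓ m' / 2)
      linarith
  obtain ⟨M₁, hM₁, hiso⟩ := hmove (η • v) (by rwa [norm_smul, Real.norm_of_nonneg hη.le])
  set m := m' + η • v with hm
  have hℓm : ℓ m = ℓ m' + η := by rw [hm, map_add, map_smul, hv, smul_eq_mul, mul_one]
  -- Half of the lift: among the edges on the negative side, the plane `ℓ = c` cuts just the two at
  -- `m`.
  set c := ℓ m' + η / 2 with hc
  have hcm : c < ℓ m := by rw [hc, hℓm]; linarith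
  have hp₀ : ℓ p₀ < c := by
    have : ℓ p₀ < 0 := by
      rcases hside _ hpm with h | h
      · exact h.1
      · exact absurd h.2 (not_lt.2 hm0.le)
    have := hle1 _ hpm this
    simp only at this
    rw [hc]; linarith
  have hq₀ : ℓ q₀ < c := by
    have : ℓ q₀ < 0 := by
      rcases hside _ hmq with h | h
      · exact h.2
      · exact absurd h.1 (not_lt.2 hm0.le)
    have := hle2 _ hmq this
    simp only at this
    rw [hc]; linarith
  obtain ⟨p, hp, hpc⟩ := exists_mem_segment_level hp₀ hcm
  obtain ⟨q, hq, hqc⟩ := exists_mem_segment_level hq₀ hcm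
  rw [segment_symm] at hq
  have hpm₁ : (p₀, m) ∈ M₁.edges := by rw [hM₁]; simp
  have hmq₁ : (m, q₀) ∈ M₁.edges := by rw [hM₁]; simp
  have hpp₀ : p ≠ p₀ := by rintro rfl; linarith
  have hpm' : p ≠ m := by rintro rfl; linarith
  have hqq₀ : q ≠ q₀ := by rintro rfl; linarith
  have hqm' : q ≠ m := by rintro rfl; linarith
  have hp₀m : p₀ ≠ m := by rintro rfl; linarith
  have hne₁ : (p₀, m) ≠ (m, q₀) := fun h => hp₀m (congrArg Prod.fst h)
  have hpq : p ≠ q := by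
    rintro rfl
    rcases (M₁.embedded _ hpm₁ _ hmq₁ hne₁ ⟨hp, hq⟩).1 with h | h
    exacts [hpp₀ h, hpm' h]
  obtain ⟨M₂, hM₂, hD₂⟩ := M₁.exists_subdivide hD hpm₁ hp hpp₀ hpm'
  have hmq₂ : (m, q₀) ∈ M₂.edges := by
    rw [hM₂]; exact Or.inr ⟨hmq₁, fun h => hne₁ (Eq.symm h)⟩
  obtain ⟨M₃, hM₃, hD₃⟩ := M₂.exists_subdivide hD hmq₂ hq hqm' hqq₀
  have hpm₃ : (p, m) ∈ M₃.edges := by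
    rw [hM₃, hM₂]
    exact Or.inr ⟨Or.inl (Or.inr rfl), fun h => hpm' (congrArg Prod.fst h)⟩
  have hmq₃ : (m, q) ∈ M₃.edges := by rw [hM₃]; simp
  have hrest : ∀ e ∈ M₃.edges, e ≠ (p, m) → e ≠ (m, q) →
      (e ∈ L.edges ∧ 0 < ℓ e.1 ∧ 0 < ℓ e.2) ∨
        ∀ x ∈ edgeSegment e, ℓ x ≤ c ∧ (ℓ x = c → x = p ∨ x = q) := by
    intro e he h1 h2
    rw [hM₃, hM₂, hM₁] at he
    rcases he with (rfl | rfl) | ⟨(rfl | rfl) | ⟨(rfl | rfl) | ⟨he, -⟩, h3⟩, h4⟩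
    · exact absurd rfl h2
    · refine Or.inr fun x hx => ⟨linear_le_of_mem_segment hx hqc.le hq₀.le, fun h => Or.inr ?_⟩
      unfold edgeSegment at hx
      rw [segment_symm] at hx
      exact eq_right_of_mem_segment hx hq₀ hqc.le h.ge
    · exact Or.inr fun x hx => ⟨linear_le_of_mem_segment hx hp₀.le hpc.le, fun h => Or.inl
        (eq_right_of_mem_segment hx hp₀ hpc.le h.ge)⟩
    · exact absurd rfl h1
    · exact absurd rfl h3
    · exact absurd rfl h4
    · rcases hside e he with h | h
      · have ha : ℓ e.1 < c := by have := hle1 e he h.1; rw [hc]; linarith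
        have hb : ℓ e.2 < c := by have := hle2 e he h.2; rw [hc]; linarith
        refine Or.inr fun x hx => ?_
        have := linear_lt_of_mem_segment hx ha hb
        exact ⟨this.le, fun h => absurd h this.ne⟩
      · exact Or.inl ⟨he, h⟩
  -- The tip is cut off. Its triangle lies in `c ≤ ℓ ≤ ℓ m < 0`, where the other edges are met at
  -- most in `p` and `q`.
  obtain ⟨M, hM, hDM⟩ := M₃.exists_triangle_merge hD hpm₃ hmq₃ (p := p) (q := q)
    (fun h => hpq (eq_right_of_mem_segment (ℓ := -ℓ) (c := -c) h (by simpa using hcm)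
      (by simp [hqc]) (by simp [hpc])))
    (fun h => by
      rw [segment_symm] at h
      exact hpq (eq_right_of_mem_segment (ℓ := -ℓ) (c := -c) h (by simpa using hcm)
        (by simp [hpc]) (by simp [hqc])).symm)
    (by
      rintro g hg h1 h2 x ⟨hx, hxg⟩
      have hx1 : c ≤ ℓ x := by
        refine convexHull_min ?_ (convex_halfSpace_ge ℓ.isLinear c) hx
        rintro y (rfl | rfl | rfl)
        exacts [hpc.ge, hqc.ge, hcm.le]
      have hx2 : ℓ x ≤ ℓ m := by
        refine convexHull_min ?_ (convex_halfSpace_le ℓ.isLinear (ℓ m)) hx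
        rintro y (rfl | rfl | rfl)
        exacts [hpc.le.trans hcm.le, hqc.le.trans hcm.le, le_refl (ℓ _)]
      rcases hrest g hg h1 h2 with ⟨-, h3, h4⟩ | h
      · have := lt_linear_of_mem_segment hxg h3 h4
        linarith
      · exact (h x hxg).2 (le_antisymm (h x hxg).1 hx1))
  refine ⟨M, p, q, c, ?_, by linarith, by rw [hM]; simp, hpc, hqc, ?_, ?_⟩
  · rw [hDM, hD₃, hD₂, hD _ _ hiso]
  · intro e he hpos
    have hno : ∀ {a b : R3}, ℓ a < 0 → e ≠ (a, b) := by
      rintro a b ha rfl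
      exact lt_asymm ha hpos
    have hm0' : ℓ m < 0 := by linarith
    rw [hM, hM₃, hM₂, hM₁]
    simp only [Set.mem_union, Set.mem_sdiff, Set.mem_insert_iff, Set.mem_singleton_iff]
    have h1 : e ≠ (p₀, m') := hno (by linarith)
    have h2 : e ≠ (m', q₀) := hno hm0
    have h3 : e ≠ (p₀, m) := hno (by linarith)
    have h4 : e ≠ (m, q₀) := hno hm0'
    have h5 : e ≠ (p, m) := hno (by linarith)
    have h6 : e ≠ (m, q) := hno hm0'
    tauto
  · intro e he hne
    rw [hM] at he
    rcases he with he | ⟨he, hen⟩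
    · exact absurd he hne
    · simp only [Set.mem_insert_iff, Set.mem_singleton_iff, not_or] at hen
      exact hrest e he hen.1 hen.2

end OrientedLink

/-! ### Isotopies that preserve the planes of constant `x`. -/

/-- The map of three-space that is affine in `x` and, on each plane `x = const`, a complex affine
map of `y + i z`. -/
noncomputable def fiberMap (a b : ℝ) (α β : ℝ → ℂ) (p : R3) : R3 :=
  (a * p.1 + b, (α p.1 * ⟨p.2.1, p.2.2⟩ + β p.1).re, (α p.1 * ⟨p.2.1, p.2.2⟩ + β p.1).im)

theorem continuous_complex_mk {X : Type*} [TopologicalSpace X] {f g : X → ℝ} (hf : Continuous f)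
    (hg : Continuous g) : Continuous fun x => (⟨f x, g x⟩ : ℂ) :=
  Complex.equivRealProdCLM.symm.continuous.comp (hf.prodMk hg)

theorem isHomeomorph_fiberMap {a : ℝ} (ha : 0 < a) (b : ℝ) {α β : ℝ → ℂ} (hα : Continuous α)
    (hβ : Continuous β) (hα0 : ∀ x, α x ≠ 0) : IsHomeomorph (fiberMap a b α β) := by
  have hcont : Continuous (fiberMap a b α β) := by
    have h : Continuous fun p : R3 => α p.1 * ⟨p.2.1, p.2.2⟩ + β p.1 :=
      ((hα.comp continuous_fst).mul (continuous_complex_mk (by fun_prop) (by fun_prop))).add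
        (hβ.comp continuous_fst)
    exact Continuous.prodMk (by fun_prop)
      ((Complex.continuous_re.comp h).prodMk (Complex.continuous_im.comp h))
  let ψ : R3 → ℂ := fun p =>
    ((⟨p.2.1, p.2.2⟩ : ℂ) - β ((p.1 - b) / a)) / α ((p.1 - b) / a)
  have hψ : Continuous ψ := by
    have h : Continuous fun p : R3 => (p.1 - b) / a := by fun_prop
    exact ((continuous_complex_mk (by fun_prop) (by fun_prop)).sub (hβ.comp h)).div
      (hα.comp h) fun p => hα0 _
  let e : R3 ≃ₜ R3 :=
    { toFun := fiberMap a b α β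
      invFun := fun p => ((p.1 - b) / a, (ψ p).re, (ψ p).im)
      left_inv := by
        rintro ⟨x, y, z⟩
        have hx : (a * x + b - b) / a = x := by field_simp; ring
        have h : ψ (fiberMap a b α β (x, y, z)) = ⟨y, z⟩ := by
          simp only [ψ, fiberMap, hx, Complex.eta]
          rw [add_sub_cancel_right]
          rw [mul_div_cancel_left₀ _ (hα0 x)]
        simp only [h]
        simp only [fiberMap, hx]
      right_inv := by
        rintro ⟨x, y, z⟩
        have h : α ((x - b) / a) * ψ (x, y, z) + β ((x - b) / a) = ⟨y, z⟩ := by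
          simp only [ψ]
          rw [mul_div_cancel₀ _ (hα0 _), sub_add_cancel]
        simp only [fiberMap, Complex.eta, h]
        congr 1
        field_simp
        ring
      continuous_toFun := hcont
      continuous_invFun := Continuous.prodMk (by fun_prop)
        ((Complex.continuous_re.comp hψ).prodMk (Complex.continuous_im.comp hψ)) }
  exact e.isHomeomorph

/-- At each time the coefficient of `x` lies between 1 and `a`, hence is positive, and `α` does not
vanish, so the map is invertible both along `x` and in the fibres. -/
theorem isAmbientIsotopy_fiberMap {a : ℝ} (ha : 0 < a) (b : ℝ) {α β : ℝ → ℝ → ℂ}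
    (hα : Continuous fun P : ℝ × ℝ => α P.1 P.2) (hβ : Continuous fun P : ℝ × ℝ => β P.1 P.2)
    (hα0 : ∀ t x, α t x ≠ 0) (hα1 : ∀ x, α 0 x = 1) (hβ1 : ∀ x, β 0 x = 0) :
    IsAmbientIsotopy fun P => fiberMap (1 + (P.1 : ℝ) * (a - 1)) (P.1 * b) (α P.1) (β P.1) P.2 := by
  refine ⟨?_, fun t => ?_, fun p => ?_⟩
  · have h1 : Continuous fun P : unitInterval × R3 => ((P.1 : ℝ), P.2.1) := by fun_prop
    have h : Continuous fun P : unitInterval × R3 =>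
        α P.1 P.2.1 * ⟨P.2.2.1, P.2.2.2⟩ + β P.1 P.2.1 :=
      ((hα.comp h1).mul (continuous_complex_mk (by fun_prop) (by fun_prop))).add (hβ.comp h1)
    exact Continuous.prodMk (by fun_prop)
      ((Complex.continuous_re.comp h).prodMk (Complex.continuous_im.comp h))
  · have h : Continuous fun x : ℝ => ((t : ℝ), x) := by fun_prop
    have h0 : 0 < 1 + (t : ℝ) * (a - 1) := by
      rcases t.2.1.eq_or_lt with ht | ht
      · rw [← ht]; norm_num
      · nlinarith [t.2.2, mul_pos ht ha]
    exact isHomeomorph_fiberMap h0 (t * b) (hα.comp h) (hβ.comp h) (hα0 t)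
  · simp [fiberMap, hα1, hβ1]

theorem OrientedLink.exists_isotopic_fiberMap (L : OrientedLink) {a : ℝ} (ha : 0 < a) (b : ℝ)
    {α β : ℝ → ℝ → ℂ} (hα : Continuous fun P : ℝ × ℝ => α P.1 P.2)
    (hβ : Continuous fun P : ℝ × ℝ => β P.1 P.2)
    (hα0 : ∀ t x, α t x ≠ 0) (hα1 : ∀ x, α 0 x = 1) (hβ1 : ∀ x, β 0 x = 0)
    (hseg : ∀ e ∈ L.edges, fiberMap a b (α 1) (β 1) '' edgeSegment e
      = edgeSegment (fiberMap a b (α 1) (β 1) e.1, fiberMap a b (α 1) (β 1) e.2)) :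
    ∃ M : OrientedLink, L.Isotopic M ∧ M.edges =
      (fun e : R3 × R3 => (fiberMap a b (α 1) (β 1) e.1, fiberMap a b (α 1) (β 1) e.2)) '' L.edges := by
  have h1 : ∀ p, fiberMap (1 + ((1 : unitInterval) : ℝ) * (a - 1)) (((1 : unitInterval) : ℝ) * b)
      (α (1 : unitInterval)) (β (1 : unitInterval)) p = fiberMap a b (α 1) (β 1) p := fun p => by
    simp
  refine ⟨_, L.isotopic_image (isAmbientIsotopy_fiberMap ha b hα hβ hα0 hα1 hβ1) ?_, ?_⟩
  · simpa only [h1] using hseg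
  · simp only [OrientedLink.image, h1]

theorem fiberMap_lineMap {a b : ℝ} {α β : ℝ → ℂ} {p q : R3} {u w : ℂ} {s : ℝ} (hp : α p.1 = u)
    (hp' : β p.1 = w) (hq : α q.1 = u) (hq' : β q.1 = w)
    (hs : α (AffineMap.lineMap p q s).1 = u) (hs' : β (AffineMap.lineMap p q s).1 = w) :
    fiberMap a b α β (AffineMap.lineMap p q s)
      = AffineMap.lineMap (fiberMap a b α β p) (fiberMap a b α β q) s := by
  simp only [fiberMap, hp, hp', hq, hq', hs, hs']
  simp only [AffineMap.lineMap_apply_module, Prod.fst_add, Prod.snd_add, Prod.smul_fst,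
    Prod.smul_snd, smul_eq_mul, Prod.smul_mk, Prod.mk_add_mk, Complex.add_re, Complex.add_im,
    Complex.mul_re, Complex.mul_im]
  refine Prod.ext ?_ (Prod.ext ?_ ?_) <;> simp only <;> ring

/-! ### Normal form of a split link. -/

/-- The endpoints of the strand by which the left part of a split link in normal form is connected
to the region `-10 ≤ x ≤ 10`. -/
def leftEnds : Set R3 := {(-10, 0, 10), (-10, 0, -10)}

/-- The endpoints of the strand by which the right part of a split link in normal form is connected
to the region `-10 ≤ x ≤ 10`. -/
def rightEnds : Set R3 := {(10, 0, 10), (10, 0, -10)}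

/-- A set of edges which meets the region `-10 ≤ x ≤ 10` only in `leftEnds` and `rightEnds`. -/
def IsBody (E : Set (R3 × R3)) : Prop :=
  ∀ e ∈ E, (∀ x ∈ edgeSegment e, x.1 ≤ -10 ∧ (x.1 = -10 → x ∈ leftEnds)) ∨
    (∀ x ∈ edgeSegment e, 10 ≤ x.1 ∧ (x.1 = 10 → x ∈ rightEnds))

/-- A continuous function that is `u` for `x ≤ c` and `w` for `d ≤ x`. -/
noncomputable def transition (c d : ℝ) (u w : ℂ) (x : ℝ) : ℂ :=
  u + (max 0 (min 1 ((x - c) / (d - c))) : ℝ) * (w - u)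

theorem continuous_transition (c d : ℝ) (u w : ℂ) : Continuous (transition c d u w) := by
  unfold transition; fun_prop

theorem transition_of_le {c d : ℝ} (h : c < d) {u w : ℂ} {x : ℝ} (hx : x ≤ c) :
    transition c d u w x = u := by
  have : (x - c) / (d - c) ≤ 0 := div_nonpos_of_nonpos_of_nonneg (by linarith) (by linarith)
  rw [transition, max_eq_left ((min_le_right _ _).trans this)]
  simp

theorem transition_of_ge {c d : ℝ} (h : c < d) {u w : ℂ} {x : ℝ} (hx : d ≤ x) :
    transition c d u w x = w := by
  have : 1 ≤ (x - c) / (d - c) := by rw [le_div_iff₀ (by linarith)]; linarith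
  rw [transition, min_eq_left this, max_eq_right zero_le_one]
  simp

/-- A complex affine map is determined by two points, and here its linear coefficient is nonzero.
Writing it as `exp k` provides the path `exp (t * k)` from 1 that avoids 0, as an isotopy requires.
-/
theorem exists_exp_mul_add {u w : ℂ} (h : u ≠ w) {u' w' : ℂ} (h' : u' ≠ w') :
    ∃ k b : ℂ, Complex.exp k * u + b = u' ∧ Complex.exp k * w + b = w' := by
  have hu : u - w ≠ 0 := sub_ne_zero.2 h
  have hu' : u' - w' ≠ 0 := sub_ne_zero.2 h'
  refine ⟨Complex.log ((u' - w') / (u - w)), u' - (u' - w') / (u - w) * u, ?_, ?_⟩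
  · rw [Complex.exp_log (div_ne_zero hu' hu)]; ring
  · rw [Complex.exp_log (div_ne_zero hu' hu)]; field_simp; ring

namespace OrientedLink

/-- Up to isotopy, a split link consists of two edges in the region `-10 ≤ x ≤ 10` and of edges
outside. -/
theorem exists_normal_form {D : OrientedLink → LaurentPolynomial ℤ} (hD : IsLinkInvariant D)
    (L : OrientedLink)
    (hside : ∀ e ∈ L.edges, (e.1.1 < 0 ∧ e.2.1 < 0) ∨ (0 < e.1.1 ∧ 0 < e.2.1))
    (hneg : ∃ e ∈ L.edges, e.1.1 < 0) (hpos : ∃ e ∈ L.edges, 0 < e.1.1) :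
    ∃ (N : OrientedLink) (E : Set (R3 × R3)), D N = D L ∧ IsBody E ∧
      N.edges = E ∪ {((-10, 0, 10), (-10, 0, -10)), ((10, 0, 10), (10, 0, -10))} := by
  obtain ⟨M₁, p, q, c, hD₁, hc, hpq₁, hpc, hqc, hkeep₁, hcls₁⟩ :=
    L.exists_extreme_edge hD (LinearMap.fst ℝ ℝ (ℝ × ℝ)) (v := (1, 0, 0)) rfl hside hneg
  simp only [LinearMap.fst_apply] at hpc hqc hkeep₁ hcls₁
  have hside₁ : ∀ e ∈ M₁.edges, (e.1.1 < 0 ∧ e.2.1 < 0) ∨ (0 < e.1.1 ∧ 0 < e.2.1) := by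
    intro e he
    by_cases hen : e = (p, q)
    · subst hen
      exact Or.inl ⟨hpc.trans_lt hc, hqc.trans_lt hc⟩
    rcases hcls₁ e he hen with h | h
    · exact Or.inr h.2
    · exact Or.inl ⟨(h _ (left_mem_segment ℝ _ _)).1.trans_lt hc,
        (h _ (right_mem_segment ℝ _ _)).1.trans_lt hc⟩
  -- The second application, with `-x`, treats the right part; the edges of the left part are kept.
  obtain ⟨M, p', q', d, hD₂, hd, hpq', hpd, hqd, hkeep, hcls⟩ :=
    M₁.exists_extreme_edge hD (-LinearMap.fst ℝ ℝ (ℝ × ℝ)) (v := (-1, 0, 0)) (by simp)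
      (fun e he => by
        simp only [LinearMap.neg_apply, LinearMap.fst_apply, Left.neg_neg_iff, Left.neg_pos_iff]
        exact (hside₁ e he).symm)
      (by
        obtain ⟨e, he, h⟩ := hpos
        exact ⟨e, hkeep₁ e he h, by simpa using h⟩)
  simp only [LinearMap.neg_apply, LinearMap.fst_apply, Left.neg_pos_iff] at hpd hqd hkeep hcls
  obtain ⟨d, rfl⟩ : ∃ d', d = -d' := ⟨-d, by simp⟩
  rw [neg_inj] at hpd hqd
  have hd : 0 < d := by linarith
  have hpq : (p, q) ∈ M.edges := hkeep _ hpq₁ (hpc.trans_lt hc)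
  have hcls : ∀ e ∈ M.edges, e ≠ (p, q) → e ≠ (p', q') →
      (∀ x ∈ edgeSegment e, x.1 ≤ c ∧ (x.1 = c → x = p ∨ x = q)) ∨
      (∀ x ∈ edgeSegment e, d ≤ x.1 ∧ (x.1 = d → x = p' ∨ x = q')) := by
    intro e he h1 h2
    rcases hcls e he h2 with h | h
    · rcases hcls₁ e h.1 h1 with h' | h'
      · exact absurd h.2.1 (not_lt.2 h'.2.1.le)
      · exact Or.inl h'
    · refine Or.inr fun x hx => ⟨by linarith [(h x hx).1], fun hxd => (h x hx).2 (by rw [hxd])⟩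
  have hcd : c < d := hc.trans hd
  have hζ : (⟨p.2.1, p.2.2⟩ : ℂ) ≠ ⟨q.2.1, q.2.2⟩ := by
    intro h
    rw [Complex.mk.injEq] at h
    exact M.nondegenerate _ hpq (Prod.ext (hpc.trans hqc.symm) (Prod.ext h.1 h.2))
  have hζ' : (⟨p'.2.1, p'.2.2⟩ : ℂ) ≠ ⟨q'.2.1, q'.2.2⟩ := by
    intro h
    rw [Complex.mk.injEq] at h
    exact M.nondegenerate _ hpq' (Prod.ext (hpd.trans hqd.symm) (Prod.ext h.1 h.2))
  have hT : (⟨0, 10⟩ : ℂ) ≠ ⟨0, -10⟩ := by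
    intro h
    rw [Complex.mk.injEq] at h
    norm_num at h
  obtain ⟨k, b, hkp, hkq⟩ := exists_exp_mul_add hζ hT
  obtain ⟨k', b', hkp', hkq'⟩ := exists_exp_mul_add hζ' hT
  set A : ℝ := 20 / (d - c) with hA
  have hA0 : 0 < A := div_pos (by norm_num) (by linarith)
  set B : ℝ := -10 - A * c with hB
  have hAc : A * c + B = -10 := by rw [hB]; ring
  have hAd : A * d + B = 10 := by
    have : A * (d - c) = 20 := div_mul_cancel₀ _ (by linarith)
    linarith
  -- The two sides need different fibre maps. They are interpolated over `c < x < d`, where the link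
  -- has no points, so no edge is bent.
  set α : ℝ → ℝ → ℂ := fun t x => Complex.exp (t * transition c d k k' x) with hα
  set β : ℝ → ℝ → ℂ := fun t x => t * transition c d b b' x with hβ
  set φ : R3 → R3 := fiberMap A B (α 1) (β 1) with hφ
  have hαl : ∀ x ≤ c, α 1 x = Complex.exp k := fun x hx => by
    simp only [hα, transition_of_le hcd hx]; simp
  have hαr : ∀ x, d ≤ x → α 1 x = Complex.exp k' := fun x hx => by
    simp only [hα, transition_of_ge hcd hx]; simp
  have hβl : ∀ x ≤ c, β 1 x = b := fun x hx => by
    simp only [hβ, transition_of_le hcd hx]; simp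
  have hβr : ∀ x, d ≤ x → β 1 x = b' := fun x hx => by
    simp only [hβ, transition_of_ge hcd hx]; simp
  have hφp : φ p = (-10, 0, 10) := by
    simp only [hφ, fiberMap, hpc, hαl c le_rfl, hβl c le_rfl, hkp, hAc]
  have hφq : φ q = (-10, 0, -10) := by
    simp only [hφ, fiberMap, hqc, hαl c le_rfl, hβl c le_rfl, hkq, hAc]
  have hφp' : φ p' = (10, 0, 10) := by
    simp only [hφ, fiberMap, hpd, hαr d le_rfl, hβr d le_rfl, hkp', hAd]
  have hφq' : φ q' = (10, 0, -10) := by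
    simp only [hφ, fiberMap, hqd, hαr d le_rfl, hβr d le_rfl, hkq', hAd]
  have hsides : ∀ e ∈ M.edges, (∀ x ∈ edgeSegment e, x.1 ≤ c) ∨
      (∀ x ∈ edgeSegment e, d ≤ x.1) := by
    intro e he
    by_cases h1 : e = (p, q)
    · subst h1
      exact Or.inl fun x hx => linear_le_of_mem_segment (ℓ := LinearMap.fst ℝ ℝ (ℝ × ℝ)) hx
        hpc.le hqc.le
    by_cases h2 : e = (p', q')
    · subst h2
      refine Or.inr fun x hx => ?_
      have := linear_le_of_mem_segment (ℓ := -LinearMap.fst ℝ ℝ (ℝ × ℝ)) (c := -d) hx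
        (by simp [hpd]) (by simp [hqd])
      simpa using this
    rcases hcls e he h1 h2 with h | h
    · exact Or.inl fun x hx => (h x hx).1
    · exact Or.inr fun x hx => (h x hx).1
  have hseg : ∀ e ∈ M.edges, φ '' edgeSegment e = edgeSegment (φ e.1, φ e.2) := by
    intro e he
    refine image_segment_of_affine fun s hs => ?_
    have hl := left_mem_segment ℝ e.1 e.2
    have hr := right_mem_segment ℝ e.1 e.2
    have hm : AffineMap.lineMap e.1 e.2 s ∈ edgeSegment e := by
      unfold edgeSegment
      rw [segment_eq_lineMap_image]
      exact ⟨s, hs, rfl⟩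
    rcases hsides e he with h | h
    · exact fiberMap_lineMap (hαl _ (h _ hl)) (hβl _ (h _ hl)) (hαl _ (h _ hr)) (hβl _ (h _ hr))
        (hαl _ (h _ hm)) (hβl _ (h _ hm))
    · exact fiberMap_lineMap (hαr _ (h _ hl)) (hβr _ (h _ hl)) (hαr _ (h _ hr)) (hβr _ (h _ hr))
        (hαr _ (h _ hm)) (hβr _ (h _ hm))
  have h1 := continuous_transition c d k k'
  have h2 := continuous_transition c d b b'
  obtain ⟨N, hI, hN⟩ := M.exists_isotopic_fiberMap hA0 B (α := α) (β := β)
    (by simp only [hα]; fun_prop) (by simp only [hβ]; fun_prop)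
    (fun t x => Complex.exp_ne_zero _) (fun x => by simp [hα]) (fun x => by simp [hβ]) hseg
  refine ⟨N, (fun e : R3 × R3 => (φ e.1, φ e.2)) '' (M.edges \ {(p, q), (p', q')}),
    (hD _ _ hI).symm.trans (hD₂.trans hD₁), ?_, ?_⟩
  · rintro _ ⟨e, ⟨he, hen⟩, rfl⟩
    simp only [Set.mem_insert_iff, Set.mem_singleton_iff, not_or] at hen
    rw [← hseg e he]
    rcases hcls e he hen.1 hen.2 with h | h
    · refine Or.inl ?_
      rintro _ ⟨x, hx, rfl⟩
      have hx1 : (φ x).1 = A * x.1 + B := rfl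
      refine ⟨?_, fun hxe => ?_⟩
      · rw [hx1, ← hAc]
        have := (h x hx).1
        gcongr
      · have : x.1 = c := by
          rw [hx1, ← hAc] at hxe
          exact mul_left_cancel₀ hA0.ne' (add_right_cancel hxe)
        rcases (h x hx).2 this with rfl | rfl
        · rw [hφp]; exact Or.inl rfl
        · rw [hφq]; exact Or.inr rfl
    · refine Or.inr ?_
      rintro _ ⟨x, hx, rfl⟩
      have hx1 : (φ x).1 = A * x.1 + B := rfl
      refine ⟨?_, fun hxe => ?_⟩
      · rw [hx1, ← hAd]
        have := (h x hx).1
        gcongr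
      · have : x.1 = d := by
          rw [hx1, ← hAd] at hxe
          exact mul_left_cancel₀ hA0.ne' (add_right_cancel hxe)
        rcases (h x hx).2 this with rfl | rfl
        · rw [hφp']; exact Or.inl rfl
        · rw [hφq']; exact Or.inr rfl
  · have hsplit : M.edges = (M.edges \ {(p, q), (p', q')}) ∪ {(p, q), (p', q')} := by
      rw [Set.sdiff_union_of_subset]
      rintro e (rfl | rfl)
      exacts [hpq, hpq']
    rw [hN]
    conv_lhs => rw [hsplit]
    rw [Set.image_union, Set.image_pair]
    congr 1
    rw [← hφ]
    simp only [hφp, hφq, hφp', hφq']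

end OrientedLink

/-! ### Integer tests for a triangle to avoid a segment. -/

/-- Integer points; the integer point `v` stands for the point `v / 2` of three-space. -/
abbrev IntPoint : Type := ℤ × ℤ × ℤ

namespace IntPoint

/-- The point of three-space that an integer point stands for. -/
noncomputable def toR3 (v : IntPoint) : R3 := ((v.1 : ℝ) / 2, (v.2.1 : ℝ) / 2, (v.2.2 : ℝ) / 2)

theorem toR3_injective : Function.Injective toR3 := by
  rintro ⟨a, b, c⟩ ⟨a', b', c'⟩ h
  simp only [toR3, Prod.mk.injEq] at h
  obtain ⟨h1, h2, h3⟩ := h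
  have h1 : (a : ℝ) = a' := by linarith
  have h2 : (b : ℝ) = b' := by linarith
  have h3 : (c : ℝ) = c' := by linarith
  norm_cast at h1 h2 h3
  rw [h1, h2, h3]

def sub (v w : IntPoint) : IntPoint := (v.1 - w.1, v.2.1 - w.2.1, v.2.2 - w.2.2)

def dot (v w : IntPoint) : ℤ := v.1 * w.1 + v.2.1 * w.2.1 + v.2.2 * w.2.2

def cross (v w : IntPoint) : IntPoint :=
  (v.2.1 * w.2.2 - v.2.2 * w.2.1, v.2.2 * w.1 - v.1 * w.2.2, v.1 * w.2.1 - v.2.1 * w.1)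

def neg (v : IntPoint) : IntPoint := (-v.1, -v.2.1, -v.2.2)

/-- The linear functional with the integer coefficients `n`. -/
noncomputable def functional (n : IntPoint) : R3 →ₗ[ℝ] ℝ :=
  (n.1 : ℝ) • LinearMap.fst ℝ ℝ (ℝ × ℝ) +
    (n.2.1 : ℝ) • (LinearMap.fst ℝ ℝ ℝ ∘ₗ LinearMap.snd ℝ ℝ (ℝ × ℝ)) +
    (n.2.2 : ℝ) • (LinearMap.snd ℝ ℝ ℝ ∘ₗ LinearMap.snd ℝ ℝ (ℝ × ℝ))

theorem functional_apply (n : IntPoint) (x : R3) :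
    n.functional x = n.1 * x.1 + n.2.1 * x.2.1 + n.2.2 * x.2.2 := rfl

theorem functional_toR3 (n v : IntPoint) : n.functional v.toR3 = (n.dot v : ℝ) / 2 := by
  rw [functional_apply]
  simp only [toR3, dot]
  push_cast
  ring

/-- The functional `n` separates the triangle `p q r` from the segment `a b`, except perhaps for a
common point that is `p` or `q`. -/
def separates (n p q r a b : IntPoint) : Bool :=
  let c := min (n.dot a) (n.dot b)
  decide (n.dot p ≤ c) && decide (n.dot q ≤ c) && decide (n.dot r ≤ c) &&
    (((decide (c < n.dot a) || a == p || a == q) && (decide (c < n.dot b) || b == p || b == q) &&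
      (decide (n.dot a ≠ n.dot b) || a == b)) ||
    (decide (n.dot r < c) && (decide (n.dot p < c) || decide (n.dot q < c) || p == q)))

/-- Normal vectors among which a separating one is searched. -/
def normals (p q r a b : IntPoint) : List IntPoint :=
  let t := q.sub p
  let u := r.sub p
  let v := r.sub q
  let s := b.sub a
  let n := t.cross u
  [(1, 0, 0), (0, 1, 0), (0, 0, 1), n, t.cross s, u.cross s, v.cross s, t.cross n, u.cross n,
    v.cross n, s.cross n, u, u.cross (u.cross s), s.cross (u.cross s), u.cross (u.cross (a.sub p))]

/-- A test for the triangle `p q r` to meet the segment `a b` at most in `p` and `q`. -/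
def triangleAvoids (p q r a b : IntPoint) : Bool :=
  (normals p q r a b).any fun n => separates n p q r a b || separates n.neg p q r a b

theorem eq_endpoint_of_linear_le {ℓ : R3 →ₗ[ℝ] ℝ} {a b x : R3} {c : ℝ} (hx : x ∈ segment ℝ a b)
    (ha : c ≤ ℓ a) (hb : c ≤ ℓ b) (hab : c < ℓ a ∨ c < ℓ b) (hxc : ℓ x ≤ c) :
    (x = a ∧ ℓ a = c) ∨ (x = b ∧ ℓ b = c) := by
  rcases hab with h | h
  · have : x = b := eq_right_of_mem_segment (ℓ := -ℓ) (c := -c) hx (by simpa using h)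
      (by simpa using hb) (by simpa using hxc)
    subst this
    exact Or.inr ⟨rfl, le_antisymm hxc hb⟩
  · rw [segment_symm] at hx
    have : x = a := eq_right_of_mem_segment (ℓ := -ℓ) (c := -c) hx (by simpa using h)
      (by simpa using ha) (by simpa using hxc)
    subst this
    exact Or.inl ⟨rfl, le_antisymm hxc ha⟩

/-- Common points lie in the plane at level `c`. The first alternative of the test says that the
segment touches this plane only in `p` or `q`, the second one that the triangle does. -/
theorem inter_subset_of_separates {n p q r a b : IntPoint} (h : separates n p q r a b = true) :
    convexHull ℝ {p.toR3, q.toR3, r.toR3} ∩ segment ℝ a.toR3 b.toR3 ⊆ {p.toR3, q.toR3} := by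
  rintro x ⟨hx, hx'⟩
  simp only [separates, Bool.and_eq_true, Bool.or_eq_true, decide_eq_true_eq, beq_iff_eq] at h
  set c := min (n.dot a) (n.dot b) with hc
  obtain ⟨⟨⟨hp, hq⟩, hr⟩, h⟩ := h
  have cast_le : ∀ {v : IntPoint}, n.dot v ≤ c → n.functional v.toR3 ≤ (c : ℝ) / 2 := fun {v} h => by
    rw [functional_toR3]
    have : (n.dot v : ℝ) ≤ c := by exact_mod_cast h
    linarith
  have cast_ge : ∀ {v : IntPoint}, c ≤ n.dot v → (c : ℝ) / 2 ≤ n.functional v.toR3 := fun {v} h => by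
    rw [functional_toR3]
    have : (c : ℝ) ≤ n.dot v := by exact_mod_cast h
    linarith
  have cast_lt : ∀ {v : IntPoint}, n.dot v < c → n.functional v.toR3 < (c : ℝ) / 2 := fun {v} h => by
    rw [functional_toR3]
    have : (n.dot v : ℝ) < c := by exact_mod_cast h
    linarith
  have cast_gt : ∀ {v : IntPoint}, c < n.dot v → (c : ℝ) / 2 < n.functional v.toR3 := fun {v} h => by
    rw [functional_toR3]
    have : (c : ℝ) < n.dot v := by exact_mod_cast h
    linarith
  have hxle : n.functional x ≤ (c : ℝ) / 2 := by
    refine convexHull_min ?_ (convex_halfSpace_le n.functional.isLinear ((c : ℝ) / 2)) hx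
    rintro y (rfl | rfl | rfl)
    exacts [cast_le hp, cast_le hq, cast_le hr]
  have hca : c ≤ n.dot a := min_le_left _ _
  have hcb : c ≤ n.dot b := min_le_right _ _
  have hxge : (c : ℝ) / 2 ≤ n.functional x :=
    (convex_halfSpace_ge n.functional.isLinear ((c : ℝ) / 2)).segment_subset (cast_ge hca)
      (cast_ge hcb) hx'
  rcases h with ⟨⟨ha, hb⟩, hab⟩ | ⟨hr, hpq⟩
  · by_cases heq : a = b
    · subst heq
      rw [segment_same] at hx'
      obtain rfl : x = a.toR3 := hx'
      rcases ha with (ha | rfl) | rfl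
      · exact absurd hxle (not_le.2 (cast_gt ha))
      · exact Or.inl rfl
      · exact Or.inr rfl
    · have hab : n.dot a ≠ n.dot b := by tauto
      have hlt : (c : ℝ) / 2 < n.functional a.toR3 ∨ (c : ℝ) / 2 < n.functional b.toR3 := by
        rcases hab.lt_or_gt with h | h
        · exact Or.inr (cast_gt (lt_of_le_of_lt hca h))
        · exact Or.inl (cast_gt (lt_of_le_of_lt hcb h))
      rcases eq_endpoint_of_linear_le hx' (cast_ge hca) (cast_ge hcb) hlt hxle with
        ⟨rfl, hx0⟩ | ⟨rfl, hx0⟩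
      · rcases ha with (ha | rfl) | rfl
        · exact absurd hxle (not_le.2 (cast_gt ha))
        · exact Or.inl rfl
        · exact Or.inr rfl
      · rcases hb with (hb | rfl) | rfl
        · exact absurd hxle (not_le.2 (cast_gt hb))
        · exact Or.inl rfl
        · exact Or.inr rfl
  · have hset : ({p.toR3, q.toR3, r.toR3} : Set R3) = insert r.toR3 {p.toR3, q.toR3} := by
      ext y
      simp only [Set.mem_insert_iff, Set.mem_singleton_iff]
      tauto
    rw [hset, convexHull_insert (by simp), convexHull_pair, mem_convexJoin] at hx
    obtain ⟨_, rfl, y, hy, hxy⟩ := hx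
    have hyle : n.functional y ≤ (c : ℝ) / 2 :=
      linear_le_of_mem_segment hy (cast_le hp) (cast_le hq)
    obtain rfl : x = y := eq_right_of_mem_segment hxy (cast_lt hr) hyle hxge
    rcases hpq with (hp' | hq') | rfl
    · exact Or.inr (eq_right_of_mem_segment hy (cast_lt hp') (cast_le hq) hxge)
    · rw [segment_symm] at hy
      exact Or.inl (eq_right_of_mem_segment hy (cast_lt hq') (cast_le hp) hxge)
    · rw [segment_same] at hy
      exact Or.inl hy

theorem inter_subset_of_triangleAvoids {p q r a b : IntPoint}
    (h : triangleAvoids p q r a b = true) :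
    convexHull ℝ {p.toR3, q.toR3, r.toR3} ∩ segment ℝ a.toR3 b.toR3 ⊆ {p.toR3, q.toR3} := by
  simp only [triangleAvoids, List.any_eq_true, Bool.or_eq_true] at h
  obtain ⟨n, -, h | h⟩ := h
  exacts [inter_subset_of_separates h, inter_subset_of_separates h]

/-- The path `p r q` does not turn back on itself. -/
def turns (p r q : IntPoint) : Bool :=
  (r.sub p).cross (q.sub r) != (0, 0, 0) || decide (0 < (r.sub p).dot (q.sub r))

theorem turns_symm {p r q : IntPoint} (h : turns p r q = true) : turns q r p = true := by
  simp only [turns, Bool.or_eq_true, bne_iff_ne, ne_eq, decide_eq_true_eq] at h ⊢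
  simp only [cross, dot, sub, Prod.mk.injEq] at h ⊢
  rcases h with h | h
  · left
    rintro ⟨h1, h2, h3⟩
    exact h ⟨by linarith, by linarith, by linarith⟩
  · right
    linarith

/-- If `p = r + t (q - r)` with `t ≥ 0`, then `r - p` is a nonpositive multiple of `q - r`: the
cross product vanishes and the dot product is not positive. -/
theorem notMem_segment_of_turns {p r q : IntPoint} (h : turns p r q = true) :
    p.toR3 ∉ segment ℝ r.toR3 q.toR3 := by
  rw [segment_eq_image']
  rintro ⟨t, ⟨ht0, -⟩, ht⟩
  simp only [toR3, Prod.ext_iff, Prod.fst_add, Prod.snd_add, Prod.smul_fst, Prod.smul_snd,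
    Prod.fst_sub, Prod.snd_sub, smul_eq_mul] at ht
  obtain ⟨h1, h2, h3⟩ := ht
  simp only [turns, Bool.or_eq_true, bne_iff_ne, ne_eq, decide_eq_true_eq] at h
  simp only [cross, dot, sub, Prod.mk.injEq] at h
  obtain ⟨p1, p2, p3⟩ := p
  obtain ⟨q1, q2, q3⟩ := q
  obtain ⟨r1, r2, r3⟩ := r
  simp only at h h1 h2 h3
  have e1 : (r1 : ℝ) - p1 = -t * (q1 - r1) := by linarith
  have e2 : (r2 : ℝ) - p2 = -t * (q2 - r2) := by linarith
  have e3 : (r3 : ℝ) - p3 = -t * (q3 - r3) := by linarith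
  rcases h with h | h
  · apply h
    refine ⟨?_, ?_, ?_⟩
    all_goals
      rw [← Int.cast_inj (α := ℝ)]
      push_cast
      simp only [e1, e2, e3]
      ring
  · rw [← Int.cast_lt (R := ℝ)] at h
    push_cast at h
    rw [e1, e2, e3] at h
    nlinarith [mul_nonneg ht0 (sq_nonneg ((q1 : ℝ) - r1)),
      mul_nonneg ht0 (sq_nonneg ((q2 : ℝ) - r2)), mul_nonneg ht0 (sq_nonneg ((q3 : ℝ) - r3))]

end IntPoint

/-! ### Certified triangle moves in the slab, with arbitrary bodies outside. -/

/-- Directed edges with integer endpoints. -/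
abbrev IntEdge : Type := IntPoint × IntPoint

/-- The directed edge in three-space that an integer edge stands for. -/
noncomputable def IntEdge.toR3 (e : IntEdge) : R3 × R3 := (IntPoint.toR3 e.1, IntPoint.toR3 e.2)

theorem IntEdge.toR3_injective : Function.Injective IntEdge.toR3 := by
  rintro ⟨a, b⟩ ⟨a', b'⟩ h
  simp only [IntEdge.toR3, Prod.mk.injEq] at h
  rw [IntPoint.toR3_injective h.1, IntPoint.toR3_injective h.2]

/-- The set of edges in three-space that a list of integer edges stands for. -/
def edgeSet (st : List IntEdge) : Set (R3 × R3) := IntEdge.toR3 '' {e | e ∈ st}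

theorem toR3_mem_edgeSet {st : List IntEdge} {e : IntEdge} (h : e ∈ st) : e.toR3 ∈ edgeSet st :=
  ⟨e, h, rfl⟩

theorem edgeSet_append (s t : List IntEdge) : edgeSet (s ++ t) = edgeSet s ∪ edgeSet t := by
  unfold edgeSet
  rw [← Set.image_union]
  congr 1
  ext e
  simp

theorem edgeSet_cons (e : IntEdge) (t : List IntEdge) :
    edgeSet (e :: t) = {e.toR3} ∪ edgeSet t := by
  unfold edgeSet
  rw [← Set.image_singleton, ← Set.image_union]
  congr 1
  ext e
  simp

theorem edgeSet_filter (st : List IntEdge) (e : IntEdge) :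
    edgeSet (st.filter (· != e)) = edgeSet st \ {e.toR3} := by
  unfold edgeSet
  rw [← Set.image_singleton, ← Set.image_sdiff IntEdge.toR3_injective]
  congr 1
  ext f
  simp

/-- The points where the part of a link in the region `-10 ≤ x ≤ 10` meets the rest. -/
def corners : List IntPoint := [(-20, 0, 20), (-20, 0, -20), (20, 0, 20), (20, 0, -20)]

def inSlab (v : IntPoint) : Bool := decide (-20 ≤ v.1) && decide (v.1 ≤ 20)

theorem inSlab_iff {v : IntPoint} : inSlab v = true ↔ -10 ≤ v.toR3.1 ∧ v.toR3.1 ≤ 10 := by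
  simp only [inSlab, Bool.and_eq_true, decide_eq_true_eq, IntPoint.toR3]
  constructor
  · rintro ⟨h1, h2⟩
    have h1 : ((-20 : ℤ) : ℝ) ≤ v.1 := by exact_mod_cast h1
    have h2 : (v.1 : ℝ) ≤ (20 : ℤ) := by exact_mod_cast h2
    push_cast at h1 h2
    constructor <;> linarith
  · rintro ⟨h1, h2⟩
    have h1 : ((-20 : ℤ) : ℝ) ≤ v.1 := by push_cast; linarith
    have h2 : (v.1 : ℝ) ≤ (20 : ℤ) := by push_cast; linarith
    exact ⟨by exact_mod_cast h1, by exact_mod_cast h2⟩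

theorem exists_corner {x : R3} (h : x ∈ leftEnds ∨ x ∈ rightEnds) :
    ∃ c ∈ corners, x = IntPoint.toR3 c := by
  rcases h with (rfl | rfl) | (rfl | rfl)
  · exact ⟨(-20, 0, 20), by simp [corners], by norm_num [IntPoint.toR3]⟩
  · exact ⟨(-20, 0, -20), by simp [corners], by norm_num [IntPoint.toR3]⟩
  · exact ⟨(20, 0, 20), by simp [corners], by norm_num [IntPoint.toR3]⟩
  · exact ⟨(20, 0, -20), by simp [corners], by norm_num [IntPoint.toR3]⟩

theorem IsBody.exists_corner {E : Set (R3 × R3)} (hE : IsBody E) {e : R3 × R3} (he : e ∈ E)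
    {x : R3} (hx : x ∈ edgeSegment e) (h1 : -10 ≤ x.1) (h2 : x.1 ≤ 10) :
    ∃ c ∈ corners, x = IntPoint.toR3 c := by
  apply _root_.exists_corner
  rcases hE e he with h | h
  · exact Or.inl ((h x hx).2 (le_antisymm (h x hx).1 h1))
  · exact Or.inr ((h x hx).2 (le_antisymm h2 (h x hx).1))

theorem pair_not_all {u w a b : R3} (hab : a ≠ b) (ha : a = u ∨ a = w) (hb : b = u ∨ b = w)
    (hm : midpoint ℝ a b = u ∨ midpoint ℝ a b = w) : False := by
  have h1 : midpoint ℝ a b ≠ a := fun h => hab ((midpoint_eq_left_iff ℝ).1 h)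
  have h2 : midpoint ℝ a b ≠ b := fun h => hab ((midpoint_eq_right_iff ℝ).1 h)
  rcases ha with rfl | rfl <;> rcases hb with rfl | rfl <;> simp_all

/-- Otherwise both endpoints and the midpoint would lie among only two points. Consequently,
removing an edge from the integer list never removes an edge of the body. -/
theorem IsBody.notMem {E : Set (R3 × R3)} (hE : IsBody E) {e : IntEdge} (hne : e.1 ≠ e.2)
    (h1 : inSlab e.1 = true) (h2 : inSlab e.2 = true) : e.toR3 ∉ E := by
  intro he
  rw [inSlab_iff] at h1 h2
  have hne' : e.toR3.1 ≠ e.toR3.2 := fun h => hne (IntPoint.toR3_injective h)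
  have hl := left_mem_segment ℝ e.toR3.1 e.toR3.2
  have hr := right_mem_segment ℝ e.toR3.1 e.toR3.2
  have hm := midpoint_mem_segment (𝕜 := ℝ) e.toR3.1 e.toR3.2
  rcases hE _ he with h | h
  · have ha : e.toR3.1.1 = -10 := le_antisymm (h _ hl).1 h1.1
    have hb : e.toR3.2.1 = -10 := le_antisymm (h _ hr).1 h2.1
    have hc : (midpoint ℝ e.toR3.1 e.toR3.2).1 = -10 := by
      rw [midpoint_eq_smul_add, Prod.smul_fst, Prod.fst_add, ha, hb]
      norm_num
    exact pair_not_all hne' ((h _ hl).2 ha) ((h _ hr).2 hb) ((h _ hm).2 hc)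
  · have ha : e.toR3.1.1 = 10 := le_antisymm h1.2 (h _ hl).1
    have hb : e.toR3.2.1 = 10 := le_antisymm h2.2 (h _ hr).1
    have hc : (midpoint ℝ e.toR3.1 e.toR3.2).1 = 10 := by
      rw [midpoint_eq_smul_add, Prod.smul_fst, Prod.fst_add, ha, hb]
      norm_num
    exact pair_not_all hne' ((h _ hl).2 ha) ((h _ hr).2 hb) ((h _ hm).2 hc)

/-- The triangle `p q r` can be used for a triangle move past the edges in `st`. -/
def triangleFree (p q r : IntPoint) (st : List IntEdge) : Bool :=
  inSlab p && inSlab q && inSlab r && IntPoint.turns p r q &&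
    st.all (fun e => IntPoint.triangleAvoids p q r e.1 e.2) &&
    corners.all (fun c => IntPoint.triangleAvoids p q r c c)

theorem convexHull_subset_slab {p q r : IntPoint} (hp : inSlab p = true) (hq : inSlab q = true)
    (hr : inSlab r = true) {x : R3} (hx : x ∈ convexHull ℝ {p.toR3, q.toR3, r.toR3}) :
    -10 ≤ x.1 ∧ x.1 ≤ 10 := by
  rw [inSlab_iff] at hp hq hr
  constructor
  · refine convexHull_min ?_ (convex_halfSpace_ge (LinearMap.fst ℝ ℝ (ℝ × ℝ)).isLinear (-10)) hx
    rintro y (rfl | rfl | rfl)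
    exacts [hp.1, hq.1, hr.1]
  · refine convexHull_min ?_ (convex_halfSpace_le (LinearMap.fst ℝ ℝ (ℝ × ℝ)).isLinear 10) hx
    rintro y (rfl | rfl | rfl)
    exacts [hp.2, hq.2, hr.2]

/-- Inside the slab the body contributes at most the four corners, so finitely many tests suffice
for an unknown `E`. A corner is tested as the degenerate segment `c c`. -/
theorem inter_subset_of_avoids {E : Set (R3 × R3)} (hE : IsBody E) {p q r : IntPoint}
    (hp : inSlab p = true) (hq : inSlab q = true) (hr : inSlab r = true) {st : List IntEdge}
    (h1 : ∀ e ∈ st, IntPoint.triangleAvoids p q r e.1 e.2 = true)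
    (h2 : ∀ c ∈ corners, IntPoint.triangleAvoids p q r c c = true) {g : R3 × R3}
    (hg : g ∈ E ∪ edgeSet st) :
    convexHull ℝ {p.toR3, q.toR3, r.toR3} ∩ edgeSegment g ⊆ {p.toR3, q.toR3} := by
  rcases hg with hg | ⟨e, he, rfl⟩
  · rintro x ⟨hx, hxg⟩
    obtain ⟨ha, hb⟩ := convexHull_subset_slab hp hq hr hx
    obtain ⟨c, hc, rfl⟩ := hE.exists_corner hg hxg ha hb
    exact IntPoint.inter_subset_of_triangleAvoids (h2 c hc) ⟨hx, left_mem_segment ℝ _ _⟩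
  · exact IntPoint.inter_subset_of_triangleAvoids (h1 e he)

/-- Moves of polygonal links: `insert p r` inserts the vertex `r` into the edge that starts at `p`,
and `delete r` removes the vertex `r`. -/
inductive PolygonMove
  | insert (p r : IntPoint)
  | delete (r : IntPoint)

/-- The list of edges after a move, if it is a triangle move. -/
def PolygonMove.apply (st : List IntEdge) : PolygonMove → Option (List IntEdge)
  | .insert p r =>
    match st.find? (fun e => e.1 == p) with
    | none => none
    | some e =>
      let rest := st.filter (· != e)
      if triangleFree e.1 e.2 r rest then some ((e.1, r) :: (r, e.2) :: rest) else none
  | .delete r =>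
    match st.find? (fun e => e.2 == r), st.find? (fun e => e.1 == r) with
    | some e, some f =>
      let rest := (st.filter (· != e)).filter (· != f)
      if triangleFree e.1 f.2 r rest then some ((e.1, f.2) :: rest) else none
    | _, _ => none

def applyMoves : List PolygonMove → List IntEdge → Option (List IntEdge)
  | [], st => some st
  | m :: ms, st =>
    match m.apply st with
    | none => none
    | some st' => applyMoves ms st'

namespace OrientedLink

/-- The link consists of the edges in `E` and the integer edges in `st`. -/
def Realizes (L : OrientedLink) (E : Set (R3 × R3)) (st : List IntEdge) : Prop :=
  L.edges = E ∪ edgeSet st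

theorem Realizes.mem {L : OrientedLink} {E : Set (R3 × R3)} {st : List IntEdge}
    (h : L.Realizes E st) {e : IntEdge} (he : e ∈ st) : e.toR3 ∈ L.edges := by
  rw [h]; exact Or.inr (toR3_mem_edgeSet he)

theorem Realizes.sdiff {L : OrientedLink} {E : Set (R3 × R3)} {st : List IntEdge}
    (h : L.Realizes E st) (hE : IsBody E) {e : IntEdge} (he : e ∈ st)
    (h1 : inSlab e.1 = true) (h2 : inSlab e.2 = true) :
    L.edges \ {e.toR3} = E ∪ edgeSet (st.filter (· != e)) := by
  have hne : e.1 ≠ e.2 := fun hh => L.nondegenerate _ (h.mem he) (congrArg IntPoint.toR3 hh)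
  rw [h, Set.union_sdiff_distrib, Set.sdiff_singleton_eq_self (hE.notMem hne h1 h2), edgeSet_filter]

theorem exists_of_apply {D : OrientedLink → LaurentPolynomial ℤ} (hD : IsLinkInvariant D)
    {E : Set (R3 × R3)} (hE : IsBody E) {L : OrientedLink} {st st' : List IntEdge}
    (hL : L.Realizes E st) {m : PolygonMove} (hm : m.apply st = some st') :
    ∃ M : OrientedLink, M.Realizes E st' ∧ D M = D L := by
  cases m with
  | insert p r =>
    simp only [PolygonMove.apply] at hm
    split at hm
    · exact absurd hm (by simp)
    rename_i e he
    split_ifs at hm with ht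
    obtain rfl := Option.some.inj hm
    have hmem := List.mem_of_find?_eq_some he
    simp only [triangleFree, Bool.and_eq_true, List.all_eq_true] at ht
    obtain ⟨⟨⟨⟨⟨hp, hq⟩, hr⟩, hturn⟩, h1⟩, h2⟩ := ht
    have hrest := hL.sdiff hE hmem hp hq
    obtain ⟨M, hM, hDM⟩ := L.exists_triangle_split hD (p := IntPoint.toR3 e.1)
      (q := IntPoint.toR3 e.2) (r := IntPoint.toR3 r) (hL.mem hmem)
      (IntPoint.notMem_segment_of_turns hturn)
      (by rw [segment_symm]; exact IntPoint.notMem_segment_of_turns (IntPoint.turns_symm hturn))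
      fun g hg hne => by
        refine inter_subset_of_avoids hE hp hq hr h1 h2 ?_
        rw [← hrest]
        exact ⟨hg, hne⟩
    refine ⟨M, ?_, hDM⟩
    have hrest' : L.edges \ {(IntPoint.toR3 e.1, IntPoint.toR3 e.2)} = _ := hrest
    rw [Realizes, hM, hrest', edgeSet_cons, edgeSet_cons]
    simp only [IntEdge.toR3]
    ext x
    simp only [Set.mem_union, Set.mem_insert_iff, Set.mem_singleton_iff]
    tauto
  | delete r =>
    simp only [PolygonMove.apply] at hm
    split at hm
    swap
    · exact absurd hm (by simp)
    rename_i e f he hf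
    split_ifs at hm with ht
    obtain rfl := Option.some.inj hm
    have hemem := List.mem_of_find?_eq_some he
    have hfmem := List.mem_of_find?_eq_some hf
    have her : e.2 = r := by simpa using List.find?_some he
    have hfr : f.1 = r := by simpa using List.find?_some hf
    simp only [triangleFree, Bool.and_eq_true, List.all_eq_true] at ht
    obtain ⟨⟨⟨⟨⟨hp, hq⟩, hr⟩, hturn⟩, h1⟩, h2⟩ := ht
    have hrest := hL.sdiff hE hemem hp (her ▸ hr)
    have hfne : f.1 ≠ f.2 := fun hh =>
      L.nondegenerate _ (hL.mem hfmem) (congrArg IntPoint.toR3 hh)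
    have hrest2 : L.edges \ {e.toR3, f.toR3} =
        E ∪ edgeSet ((st.filter (· != e)).filter (· != f)) := by
      rw [← Set.singleton_union, ← Set.sdiff_sdiff, hrest, Set.union_sdiff_distrib,
        Set.sdiff_singleton_eq_self (hE.notMem hfne (hfr ▸ hr) hq), ← edgeSet_filter]
    have hee : e.toR3 = (IntPoint.toR3 e.1, IntPoint.toR3 r) := by rw [← her]; rfl
    have hff : f.toR3 = (IntPoint.toR3 r, IntPoint.toR3 f.2) := by rw [← hfr]; rfl
    rw [hee, hff] at hrest2
    obtain ⟨M, hM, hDM⟩ := L.exists_triangle_merge hD (p := IntPoint.toR3 e.1)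
      (q := IntPoint.toR3 f.2) (r := IntPoint.toR3 r) (hee ▸ hL.mem hemem) (hff ▸ hL.mem hfmem)
      (IntPoint.notMem_segment_of_turns hturn)
      (by rw [segment_symm]; exact IntPoint.notMem_segment_of_turns (IntPoint.turns_symm hturn))
      fun g hg hne hne' => by
        refine inter_subset_of_avoids hE hp hq hr h1 h2 ?_
        rw [← hrest2]
        exact ⟨hg, by simp [hne, hne']⟩
    refine ⟨M, ?_, hDM⟩
    rw [Realizes, hM, hrest2, edgeSet_cons]
    simp only [IntEdge.toR3]
    ext x
    simp only [Set.mem_union, Set.mem_singleton_iff]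
    tauto

theorem exists_of_applyMoves {D : OrientedLink → LaurentPolynomial ℤ} (hD : IsLinkInvariant D)
    {E : Set (R3 × R3)} (hE : IsBody E) {ms : List PolygonMove} : ∀ {L : OrientedLink}
    {st st' : List IntEdge}, L.Realizes E st → applyMoves ms st = some st' →
    ∃ M : OrientedLink, M.Realizes E st' ∧ D M = D L := by
  induction ms with
  | nil =>
    intro L st st' hL h
    obtain rfl := Option.some.inj h
    exact ⟨L, hL, rfl⟩
  | cons m ms ih =>
    intro L st st' hL h
    simp only [applyMoves] at h
    split at h
    · exact absurd h (by simp)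
    rename_i st₁ h₁
    obtain ⟨M, hM, hDM⟩ := exists_of_apply hD hE hL h₁
    obtain ⟨N, hN, hDN⟩ := ih hM h
    exact ⟨N, hN, hDN.trans hDM⟩

end OrientedLink

/-! ### Constructing links that need not be isotopic to the given one. -/

/-- Insert vertices `r` into edges starting at `p`, for the pairs `(p, r)` in a list, provided that
the result is embedded. -/
def insertVertices : List (IntPoint × IntPoint) → List IntEdge → Option (List IntEdge)
  | [], st => some st
  | (p, r) :: ms, st =>
    match st.find? (fun e => e.1 == p) with
    | none => none
    | some e =>
      let rest := st.filter (· != e)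
      if inSlab e.1 && inSlab e.2 && inSlab r && IntPoint.turns e.1 r e.2 &&
          (rest.all fun f => IntPoint.triangleAvoids e.1 e.1 r f.1 f.2 &&
            IntPoint.triangleAvoids e.2 e.2 r f.1 f.2) &&
          (corners.all fun c => IntPoint.triangleAvoids e.1 e.1 r c c &&
            IntPoint.triangleAvoids e.2 e.2 r c c) then
        insertVertices ms ((e.1, r) :: (r, e.2) :: rest)
      else none

namespace OrientedLink

/-- Only the two new edges, as degenerate triangles, must avoid the rest; the triangle they span may
be pierced. So strands can pass through each other, and nothing is claimed about `D`. -/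
theorem exists_of_insertVertices {E : Set (R3 × R3)} (hE : IsBody E)
    {ms : List (IntPoint × IntPoint)} : ∀ {L : OrientedLink} {st st' : List IntEdge},
    L.Realizes E st → insertVertices ms st = some st' → ∃ M : OrientedLink, M.Realizes E st' := by
  induction ms with
  | nil =>
    intro L st st' hL h
    obtain rfl := Option.some.inj h
    exact ⟨L, hL⟩
  | cons m ms ih =>
    obtain ⟨p, r⟩ := m
    intro L st st' hL h
    simp only [insertVertices] at h
    split at h
    · exact absurd h (by simp)
    rename_i e he
    split_ifs at h with ht
    have hmem := List.mem_of_find?_eq_some he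
    simp only [Bool.and_eq_true, List.all_eq_true] at ht
    obtain ⟨⟨⟨⟨⟨hp, hq⟩, hr⟩, hturn⟩, h1⟩, h2⟩ := ht
    have hrest := hL.sdiff hE hmem hp hq
    have hrest' : L.edges \ {(IntPoint.toR3 e.1, IntPoint.toR3 e.2)} = _ := hrest
    refine ih (L := L.splitEdge (p := IntPoint.toR3 e.1) (q := IntPoint.toR3 e.2) (hL.mem hmem)
      (IntPoint.toR3 r) (IntPoint.notMem_segment_of_turns hturn)
      (by rw [segment_symm]; exact IntPoint.notMem_segment_of_turns (IntPoint.turns_symm hturn))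
      ?_) ?_ h
    · intro g hg hne
      have hg' : g ∈ E ∪ edgeSet (st.filter (· != e)) := by
        rw [← hrest]
        exact ⟨hg, hne⟩
      have ha := inter_subset_of_avoids hE hp hp hr (fun f hf => (h1 f hf).1)
        (fun c hc => (h2 c hc).1) hg'
      have hb := inter_subset_of_avoids hE hq hq hr (fun f hf => (h1 f hf).2)
        (fun c hc => (h2 c hc).2) hg'
      simp only [Set.insert_eq_of_mem, Set.mem_insert_iff, true_or, convexHull_pair,
        Set.mem_singleton_iff] at ha hb
      rintro x ⟨hx | hx, hxg⟩
      · exact Or.inl (ha ⟨hx, hxg⟩)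
      · rw [segment_symm] at hx
        exact Or.inr (hb ⟨hx, hxg⟩)
    · rw [Realizes]
      simp only [splitEdge]
      rw [hrest', edgeSet_cons, edgeSet_cons]
      simp only [IntEdge.toR3]
      ext x
      simp only [Set.mem_union, Set.mem_insert_iff, Set.mem_singleton_iff]
      tauto

end OrientedLink

/-! ### A full turn of the left body. -/

/-- A closed path around the origin, along a square, with `squarePath k = i ^ k` for `k ≤ 4`. -/
noncomputable def squarePath (u : ℝ) : ℂ :=
  ⟨max (1 - u) (u - 3), max (min u (2 - u)) (u - 4)⟩

theorem continuous_squarePath : Continuous squarePath :=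
  continuous_complex_mk (by fun_prop) (by fun_prop)

theorem squarePath_ne_zero (u : ℝ) : squarePath u ≠ 0 := by
  intro h
  have hre : max (1 - u) (u - 3) = 0 := congrArg Complex.re h
  have him : max (min u (2 - u)) (u - 4) = 0 := congrArg Complex.im h
  rcases le_total u 2 with h2 | h2
  · rw [max_eq_left (by linarith)] at hre
    rw [min_eq_left (by linarith), max_eq_left (by linarith)] at him
    linarith
  · rw [max_eq_right (by linarith)] at hre
    rw [min_eq_right (by linarith), max_eq_right (by linarith)] at him
    linarith

theorem squarePath_zero : squarePath 0 = 1 := by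
  apply Complex.ext <;> norm_num [squarePath]

/-- The number of quarter turns by which the twist rotates the plane at `x`. -/
noncomputable def quarterTurns (x : ℝ) : ℝ := max 0 (min 4 (-16 - 2 * x))

theorem quarterTurns_of_le {x : ℝ} (h : x ≤ -10) : quarterTurns x = 4 := by
  rw [quarterTurns, min_eq_left (by linarith), max_eq_right (by norm_num)]

theorem quarterTurns_of_ge {x : ℝ} (h : -8 ≤ x) : quarterTurns x = 0 := by
  rw [quarterTurns, max_eq_left ((min_le_right _ _).trans (by linarith))]

theorem quarterTurns_of_mem {x : ℝ} (h : -10 ≤ x) (h' : x ≤ -8) :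
    quarterTurns x = -16 - 2 * x := by
  rw [quarterTurns, min_eq_right (by linarith), max_eq_right (by linarith)]

/-- A full turn of the left half-space about the `x`-axis. -/
noncomputable def twist : R3 → R3 := fiberMap 1 0 (fun x => squarePath (quarterTurns x)) fun _ => 0

theorem squarePath_four : squarePath 4 = 1 := by
  apply Complex.ext <;> norm_num [squarePath]

theorem twist_of_eq_one {p : R3} (h : squarePath (quarterTurns p.1) = 1) : twist p = p := by
  simp [twist, fiberMap, h]

theorem twist_of_le {p : R3} (h : p.1 ≤ -10) : twist p = p :=
  twist_of_eq_one (by rw [quarterTurns_of_le h, squarePath_four])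

theorem twist_of_ge {p : R3} (h : -8 ≤ p.1) : twist p = p :=
  twist_of_eq_one (by rw [quarterTurns_of_ge h, squarePath_zero])

/-- Each interval of length `1/2` in `x` corresponds to one side of the square. This is the reason
for turning along a square: a path along a circle would bend the edges. -/
theorem exists_squarePath_affine {k : ℤ} (hk : -20 ≤ k) (hk' : k ≤ -17) : ∃ A B : ℂ,
    ∀ x : ℝ, k ≤ 2 * x → 2 * x ≤ k + 1 → squarePath (quarterTurns x) = A * x + B := by
  have h10 : ∀ x : ℝ, k ≤ 2 * x → 2 * x ≤ k + 1 → quarterTurns x = -16 - 2 * x := by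
    intro x h h'
    have h1 : ((-20 : ℤ) : ℝ) ≤ k := by exact_mod_cast hk
    have h2 : (k : ℝ) ≤ ((-17 : ℤ) : ℝ) := by exact_mod_cast hk'
    push_cast at h1 h2
    exact quarterTurns_of_mem (by linarith) (by linarith)
  have key : ∃ A B : ℂ, ∀ x : ℝ, (k : ℝ) ≤ 2 * x → 2 * x ≤ k + 1 →
      squarePath (-16 - 2 * x) = A * x + B := by
    obtain rfl | rfl | rfl | rfl : k = -20 ∨ k = -19 ∨ k = -18 ∨ k = -17 := by omega
    · refine ⟨⟨-2, -2⟩, ⟨-19, -20⟩, fun x h h' => ?_⟩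
      push_cast at h h'
      apply Complex.ext <;> simp only [squarePath, Complex.add_re, Complex.add_im, Complex.mul_re,
        Complex.mul_im, Complex.ofReal_re, Complex.ofReal_im]
      · rw [max_eq_right (by linarith)]; ring
      · rw [min_eq_right (by linarith), max_eq_right (by linarith)]; ring
    · refine ⟨⟨-2, 2⟩, ⟨-19, 18⟩, fun x h h' => ?_⟩
      push_cast at h h'
      apply Complex.ext <;> simp only [squarePath, Complex.add_re, Complex.add_im, Complex.mul_re,
        Complex.mul_im, Complex.ofReal_re, Complex.ofReal_im]
      · rw [max_eq_right (by linarith)]; ring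
      · rw [min_eq_right (by linarith), max_eq_left (by linarith)]; ring
    · refine ⟨⟨2, 2⟩, ⟨17, 18⟩, fun x h h' => ?_⟩
      push_cast at h h'
      apply Complex.ext <;> simp only [squarePath, Complex.add_re, Complex.add_im, Complex.mul_re,
        Complex.mul_im, Complex.ofReal_re, Complex.ofReal_im]
      · rw [max_eq_left (by linarith)]; ring
      · rw [min_eq_right (by linarith), max_eq_left (by linarith)]; ring
    · refine ⟨⟨2, -2⟩, ⟨17, -16⟩, fun x h h' => ?_⟩
      push_cast at h h'
      apply Complex.ext <;> simp only [squarePath, Complex.add_re, Complex.add_im, Complex.mul_re,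
        Complex.mul_im, Complex.ofReal_re, Complex.ofReal_im]
      · rw [max_eq_left (by linarith)]; ring
      · rw [min_eq_left (by linarith), max_eq_left (by linarith)]; ring
  obtain ⟨A, B, h⟩ := key
  exact ⟨A, B, fun x hx hx' => by rw [h10 x hx hx', h x hx hx']⟩

/-- On an edge parallel to the `x`-axis the fibre coordinate is constant, so its product with an
affine `α` is still affine. -/
theorem fiberMap_lineMap_of_snd_eq {a b : ℝ} {α : ℝ → ℂ} {p q : R3} {A B : ℂ} {s : ℝ}
    (hpq : p.2 = q.2) (hp : α p.1 = A * p.1 + B) (hq : α q.1 = A * q.1 + B)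
    (hs : α (AffineMap.lineMap p q s).1 = A * (AffineMap.lineMap p q s).1 + B) :
    fiberMap a b α (fun _ => 0) (AffineMap.lineMap p q s)
      = AffineMap.lineMap (fiberMap a b α (fun _ => 0) p) (fiberMap a b α (fun _ => 0) q) s := by
  obtain ⟨x, y⟩ := p
  obtain ⟨x', y'⟩ := q
  obtain rfl : y = y' := hpq
  simp only [fiberMap, hp, hq, hs]
  simp only [AffineMap.lineMap_apply_module, Prod.fst_add, Prod.snd_add, Prod.smul_fst,
    Prod.smul_snd, smul_eq_mul, Prod.smul_mk, Prod.mk_add_mk, Complex.add_re, Complex.add_im,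
    Complex.mul_re, Complex.mul_im, Complex.ofReal_re, Complex.ofReal_im, Complex.zero_re,
    Complex.zero_im]
  refine Prod.ext ?_ (Prod.ext ?_ ?_) <;> simp only <;> ring

/-- The effect of the twist on integer points. -/
def IntPoint.twist (v : IntPoint) : IntPoint :=
  if v.1 = -17 then (v.1, -v.2.2, v.2.1)
  else if v.1 = -18 then (v.1, -v.2.1, -v.2.2)
  else if v.1 = -19 then (v.1, v.2.2, -v.2.1)
  else v

/-- Between `x = -10` and `x = -8`, integer points sit at whole numbers of quarter turns, so their
images are again integer points. -/
theorem IntPoint.toR3_twist {v : IntPoint} (h : -20 ≤ v.1) : v.twist.toR3 = _root_.twist v.toR3 := by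
  obtain ⟨x, y, z⟩ := v
  simp only at h
  rcases le_or_gt (-16) x with h16 | h16
  · have : (IntPoint.toR3 (x, y, z)).1 ≥ -8 := by
      have : ((-16 : ℤ) : ℝ) ≤ x := by exact_mod_cast h16
      push_cast at this
      simp only [IntPoint.toR3]
      linarith
    rw [twist_of_ge this, IntPoint.twist, if_neg (by simp only; omega), if_neg (by simp only; omega),
      if_neg (by simp only; omega)]
  · obtain rfl | rfl | rfl | rfl : x = -20 ∨ x = -19 ∨ x = -18 ∨ x = -17 := by omega
    all_goals
      norm_num [IntPoint.twist, IntPoint.toR3, _root_.twist, fiberMap, quarterTurns, squarePath,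
        Complex.mul_re, Complex.mul_im, neg_div]

/-- A test for edges that the twist maps to edges. -/
def twistable (e : IntEdge) : Bool :=
  (decide (-16 ≤ e.1.1) && decide (-16 ≤ e.2.1)) ||
    (e.1.2 == e.2.2 && [-20, -19, -18, -17].any fun k =>
      decide (k ≤ e.1.1) && decide (e.1.1 ≤ k + 1) && decide (k ≤ e.2.1) && decide (e.2.1 ≤ k + 1))

theorem le_toR3_fst {v : IntPoint} {k : ℤ} : (k : ℝ) ≤ 2 * v.toR3.1 ↔ k ≤ v.1 := by
  rw [← Int.cast_le (R := ℝ), IntPoint.toR3, mul_div_cancel₀ _ two_ne_zero]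

theorem toR3_fst_le {v : IntPoint} {k : ℤ} : 2 * v.toR3.1 ≤ (k : ℝ) ↔ v.1 ≤ k := by
  rw [← Int.cast_le (R := ℝ), IntPoint.toR3, mul_div_cancel₀ _ two_ne_zero]

theorem mem_segment_fst_bounds {p q x : R3} (hx : x ∈ segment ℝ p q) {c : ℝ} :
    (c ≤ p.1 → c ≤ q.1 → c ≤ x.1) ∧ (p.1 ≤ c → q.1 ≤ c → x.1 ≤ c) :=
  ⟨fun h h' => (convex_halfSpace_ge (LinearMap.fst ℝ ℝ (ℝ × ℝ)).isLinear c).segment_subset h h' hx,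
    fun h h' => (convex_halfSpace_le (LinearMap.fst ℝ ℝ (ℝ × ℝ)).isLinear c).segment_subset h h' hx⟩

theorem twist_image_segment {e : IntEdge} (h : twistable e = true) :
    twist '' edgeSegment e.toR3 = edgeSegment (twist e.toR3.1, twist e.toR3.2) := by
  refine image_segment_of_affine fun s hs => ?_
  have hm : AffineMap.lineMap (IntPoint.toR3 e.1) (IntPoint.toR3 e.2) s ∈
      segment ℝ (IntPoint.toR3 e.1) (IntPoint.toR3 e.2) := by
    rw [segment_eq_lineMap_image]
    exact ⟨s, hs, rfl⟩
  simp only [twistable, Bool.or_eq_true, Bool.and_eq_true, decide_eq_true_eq, beq_iff_eq,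
    List.any_eq_true] at h
  rcases h with ⟨h1, h2⟩ | ⟨h0, k, hk, ⟨⟨⟨h1, h2⟩, h3⟩, h4⟩⟩
  · rw [← le_toR3_fst] at h1 h2
    push_cast at h1 h2
    have h1 : -8 ≤ (IntPoint.toR3 e.1).1 := by linarith
    have h2 : -8 ≤ (IntPoint.toR3 e.2).1 := by linarith
    rw [twist_of_ge h1, twist_of_ge h2, twist_of_ge ((mem_segment_fst_bounds hm).1 h1 h2)]
  · have hk' : -20 ≤ k ∧ k ≤ -17 := by
      simp only [List.mem_cons, List.not_mem_nil, or_false] at hk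
      omega
    obtain ⟨A, B, hAB⟩ := exists_squarePath_affine hk'.1 hk'.2
    rw [← le_toR3_fst] at h1 h3
    rw [← toR3_fst_le] at h2 h4
    push_cast at h2 h4
    refine fiberMap_lineMap_of_snd_eq ?_ (hAB _ h1 h2) (hAB _ h3 h4) (hAB _ ?_ ?_)
    · simp only [IntPoint.toR3, h0]
    · have := (mem_segment_fst_bounds hm (c := k / 2)).1 (by linarith) (by linarith)
      linarith
    · have := (mem_segment_fst_bounds hm (c := (k + 1) / 2)).2 (by linarith) (by linarith)
      linarith

/-- Four quarter turns bring the left body back to its place, and the right body is never turned. -/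
theorem twist_of_isBody {E : Set (R3 × R3)} (hE : IsBody E) {e : R3 × R3} (he : e ∈ E) {x : R3}
    (hx : x ∈ edgeSegment e) : twist x = x := by
  rcases hE e he with h | h
  · exact twist_of_le (h x hx).1
  · exact twist_of_ge (by linarith [(h x hx).1])

/-- Scaling the number of quarter turns by time gives the isotopy. It moves the left body on the
way, which triangle moves in the slab cannot do. -/
theorem OrientedLink.exists_of_twist {D : OrientedLink → LaurentPolynomial ℤ}
    (hD : IsLinkInvariant D) {E : Set (R3 × R3)} (hE : IsBody E) {L : OrientedLink}
    {st : List IntEdge} (hL : L.Realizes E st) (ht : st.all twistable = true) :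
    ∃ M : OrientedLink, M.Realizes E (st.map fun e => (e.1.twist, e.2.twist)) ∧ D M = D L := by
  rw [List.all_eq_true] at ht
  have hq : Continuous quarterTurns := by unfold quarterTurns; fun_prop
  obtain ⟨M, hI, hM⟩ := L.exists_isotopic_fiberMap one_pos 0
    (α := fun t x => squarePath (t * quarterTurns x)) (β := fun _ _ => 0)
    (continuous_squarePath.comp (by fun_prop)) continuous_const
    (fun t x => squarePath_ne_zero _) (fun x => by rw [zero_mul, squarePath_zero]) (fun _ => rfl)
    (by
      simp only [one_mul]
      change ∀ e ∈ L.edges, twist '' edgeSegment e = edgeSegment (twist e.1, twist e.2)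
      intro e he
      rw [hL] at he
      rcases he with he | ⟨e, he, rfl⟩
      · rw [twist_of_isBody hE he (left_mem_segment ℝ _ _),
          twist_of_isBody hE he (right_mem_segment ℝ _ _)]
        exact (Set.image_congr fun x hx => twist_of_isBody hE he hx).trans (Set.image_id' _)
      · exact twist_image_segment (ht e he))
  refine ⟨M, ?_, (hD _ _ hI).symm⟩
  simp only [one_mul] at hM
  change M.edges = (fun e : R3 × R3 => (twist e.1, twist e.2)) '' L.edges at hM
  rw [Realizes, hM, hL, Set.image_union]
  congr 1
  · refine (Set.image_congr fun e he => ?_).trans (Set.image_id' _)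
    rw [twist_of_isBody hE he (left_mem_segment ℝ _ _),
      twist_of_isBody hE he (right_mem_segment ℝ _ _)]
  · have hx : ∀ e ∈ st, -20 ≤ e.1.1 ∧ -20 ≤ e.2.1 := by
      intro e he
      have h := ht e he
      simp only [twistable, Bool.or_eq_true, Bool.and_eq_true, decide_eq_true_eq, beq_iff_eq,
        List.any_eq_true] at h
      rcases h with ⟨h1, h2⟩ | ⟨h0, k, hk, ⟨⟨⟨h1, h2⟩, h3⟩, h4⟩⟩
      · omega
      · simp only [List.mem_cons, List.not_mem_nil, or_false] at hk
        omega
    simp only [edgeSet]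
    ext f
    simp only [Set.mem_image, Set.mem_ofPred_eq, List.mem_map]
    constructor
    · rintro ⟨_, ⟨e, he, rfl⟩, rfl⟩
      refine ⟨_, ⟨e, he, rfl⟩, ?_⟩
      simp only [IntEdge.toR3, IntPoint.toR3_twist (hx e he).1, IntPoint.toR3_twist (hx e he).2]
    · rintro ⟨_, ⟨e, he, rfl⟩, rfl⟩
      refine ⟨_, ⟨e, he, rfl⟩, ?_⟩
      simp only [IntEdge.toR3, IntPoint.toR3_twist (hx e he).1, IntPoint.toR3_twist (hx e he).2]

/-! ### Geometric braids as lists of integer edges. -/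

/-- The two lists have the same members. -/
def sameEdges (s t : List IntEdge) : Bool := s.all t.contains && t.all s.contains

theorem edgeSet_eq_of_sameEdges {s t : List IntEdge} (h : sameEdges s t = true) :
    edgeSet s = edgeSet t := by
  simp only [sameEdges, Bool.and_eq_true, List.all_eq_true, List.contains_iff_mem] at h
  unfold edgeSet
  congr 1
  ext e
  exact ⟨h.1 e, h.2 e⟩

/-- The edges of `crossingEdges n i (d / 2) h`, as integer edges. -/
def crossingList (n i : ℕ) (d h : ℤ) : List IntEdge :=
  ((List.range n).filterMap fun (j : ℕ) =>
    if j + 1 ≠ i ∧ j ≠ i then some ((2 * (j : ℤ) + 2, 0, 2 * h + 2), (2 * (j : ℤ) + 2, 0, 2 * h))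
    else none) ++
  [((2 * (i : ℤ), 0, 2 * h + 2), (2 * (i : ℤ) + 1, d, 2 * h + 1)),
   ((2 * (i : ℤ) + 1, d, 2 * h + 1), (2 * (i : ℤ) + 2, 0, 2 * h)),
   ((2 * (i : ℤ) + 2, 0, 2 * h + 2), (2 * (i : ℤ) + 1, -d, 2 * h + 1)),
   ((2 * (i : ℤ) + 1, -d, 2 * h + 1), (2 * (i : ℤ), 0, 2 * h))]

/-- The edges of `layerEdges n h`, as integer edges. -/
def layerList (n : ℕ) (h : ℤ) : BraidLetter → List IntEdge
  | .one => (List.range n).map fun (j : ℕ) =>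
      ((2 * (j : ℤ) + 2, 0, 2 * h + 2), (2 * (j : ℤ) + 2, 0, 2 * h))
  | .sigma i => crossingList n i 1 h
  | .sigmaInv i => crossingList n i (-1) h

/-- The edges of `braidEdges n w`, as integer edges. -/
def braidList (n : ℕ) : List BraidLetter → List IntEdge
  | [] => []
  | l :: w => layerList n w.length l ++ braidList n w

theorem toR3_vertical (j : ℕ) (h : ℤ) :
    IntEdge.toR3 ((2 * (j : ℤ) + 2, 0, 2 * h + 2), (2 * (j : ℤ) + 2, 0, 2 * h))
      = ((((j + 1 : ℕ) : ℝ), 0, (h : ℝ) + 1), (((j + 1 : ℕ) : ℝ), 0, (h : ℝ))) := by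
  simp only [IntEdge.toR3, IntPoint.toR3]
  push_cast
  simp only [Prod.mk.injEq]
  refine ⟨⟨?_, ?_, ?_⟩, ?_, ?_, ?_⟩ <;> ring

/-- The list counts strands from 0 and the braid counts them from 1, which shifts the excluded
indices. -/
theorem crossingEdges_eq_edgeSet (n i : ℕ) (d h : ℤ) :
    crossingEdges n i ((d : ℝ) / 2) h = edgeSet (crossingList n i d h) := by
  rw [crossingList, edgeSet_append, crossingEdges]
  congr 1
  · ext e
    simp only [Set.mem_ofPred_eq, edgeSet, Set.mem_image, List.mem_filterMap, List.mem_range,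
      Option.ite_none_right_eq_some, Option.some.injEq]
    constructor
    · rintro ⟨j, h1, h2, h3, h4, rfl⟩
      obtain ⟨k, rfl⟩ : ∃ k, j = k + 1 := ⟨j - 1, by omega⟩
      exact ⟨_, ⟨k, by omega, ⟨h3, by omega⟩, rfl⟩, toR3_vertical k h⟩
    · rintro ⟨_, ⟨k, hk, ⟨h1, h2⟩, rfl⟩, rfl⟩
      exact ⟨k + 1, by omega, by omega, h1, by omega, toR3_vertical k h⟩
  · simp only [edgeSet_cons]
    have : edgeSet [] = ∅ := by simp [edgeSet]
    rw [this, Set.union_empty]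
    simp only [Set.singleton_union]
    have e1 : IntEdge.toR3 ((2 * (i : ℤ), 0, 2 * h + 2), (2 * (i : ℤ) + 1, d, 2 * h + 1)) =
        (((i : ℝ), 0, (h : ℝ) + 1), ((i : ℝ) + 1 / 2, (d : ℝ) / 2, (h : ℝ) + 1 / 2)) := by
      simp only [IntEdge.toR3, IntPoint.toR3, Prod.mk.injEq]
      push_cast
      refine ⟨⟨?_, ?_, ?_⟩, ?_, ?_, ?_⟩ <;> first | trivial | ring
    have e2 : IntEdge.toR3 ((2 * (i : ℤ) + 1, d, 2 * h + 1), (2 * (i : ℤ) + 2, 0, 2 * h)) =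
        (((i : ℝ) + 1 / 2, (d : ℝ) / 2, (h : ℝ) + 1 / 2), ((i : ℝ) + 1, 0, (h : ℝ))) := by
      simp only [IntEdge.toR3, IntPoint.toR3, Prod.mk.injEq]
      push_cast
      refine ⟨⟨?_, ?_, ?_⟩, ?_, ?_, ?_⟩ <;> first | trivial | ring
    have e3 : IntEdge.toR3 ((2 * (i : ℤ) + 2, 0, 2 * h + 2), (2 * (i : ℤ) + 1, -d, 2 * h + 1)) =
        (((i : ℝ) + 1, 0, (h : ℝ) + 1), ((i : ℝ) + 1 / 2, -((d : ℝ) / 2), (h : ℝ) + 1 / 2)) := by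
      simp only [IntEdge.toR3, IntPoint.toR3, Prod.mk.injEq]
      push_cast
      refine ⟨⟨?_, ?_, ?_⟩, ?_, ?_, ?_⟩ <;> ring
    have e4 : IntEdge.toR3 ((2 * (i : ℤ) + 1, -d, 2 * h + 1), (2 * (i : ℤ), 0, 2 * h)) =
        (((i : ℝ) + 1 / 2, -((d : ℝ) / 2), (h : ℝ) + 1 / 2), ((i : ℝ), 0, (h : ℝ))) := by
      simp only [IntEdge.toR3, IntPoint.toR3, Prod.mk.injEq]
      push_cast
      refine ⟨⟨?_, ?_, ?_⟩, ?_, ?_, ?_⟩ <;> ring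
    rw [e1, e2, e3, e4]

theorem layerEdges_eq_edgeSet (n : ℕ) (h : ℤ) (l : BraidLetter) :
    layerEdges n h l = edgeSet (layerList n h l) := by
  cases l with
  | one =>
    ext e
    simp only [layerEdges, layerList, Set.mem_ofPred_eq, edgeSet, Set.mem_image, List.mem_map,
      List.mem_range]
    constructor
    · rintro ⟨j, h1, h2, rfl⟩
      obtain ⟨k, rfl⟩ : ∃ k, j = k + 1 := ⟨j - 1, by omega⟩
      exact ⟨_, ⟨k, by omega, rfl⟩, toR3_vertical k h⟩
    · rintro ⟨_, ⟨k, hk, rfl⟩, rfl⟩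
      exact ⟨k + 1, by omega, by omega, toR3_vertical k h⟩
  | sigma i =>
    have := crossingEdges_eq_edgeSet n i 1 h
    rwa [Int.cast_one] at this
  | sigmaInv i =>
    have := crossingEdges_eq_edgeSet n i (-1) h
    rwa [Int.cast_neg, Int.cast_one, neg_div] at this

theorem braidEdges_eq_edgeSet (n : ℕ) (w : List BraidLetter) :
    braidEdges n w = edgeSet (braidList n w) := by
  induction w with
  | nil => simp [braidEdges, braidList, edgeSet]
  | cons l w ih =>
    rw [braidEdges, braidList, edgeSet_append, ih, ← layerEdges_eq_edgeSet]
    simp only [Int.cast_natCast]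

/-- The endpoints of `n`-braids of length `k`, as integer points. -/
def endpointList (n k : ℕ) : List IntPoint :=
  (List.range n).flatMap fun (j : ℕ) =>
    [(2 * (j : ℤ) + 2, 0, 2 * (k : ℤ)), (2 * (j : ℤ) + 2, 0, 0)]

theorem toR3_mem_braidEndpoints {n k : ℕ} {v : IntPoint} (h : v ∈ endpointList n k) :
    v.toR3 ∈ braidEndpoints n k := by
  simp only [endpointList, List.mem_flatMap, List.mem_range, List.mem_cons, List.not_mem_nil,
    or_false] at h
  obtain ⟨j, hj, rfl | rfl⟩ := h
  · refine ⟨j + 1, by omega, by omega, Or.inl ?_⟩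
    simp only [IntPoint.toR3, Prod.mk.injEq]
    push_cast
    refine ⟨?_, ?_, ?_⟩ <;> ring
  · refine ⟨j + 1, by omega, by omega, Or.inr ?_⟩
    simp only [IntPoint.toR3, Prod.mk.injEq]
    push_cast
    refine ⟨?_, ?_, ?_⟩ <;> ring

/-- Half-spaces `c ≤ ⟨ν, v⟩` (for integer points `v`) which meet the cylinder at most in boundary
points. -/
def outerHalfSpaces (k : ℕ) : List (IntPoint × ℤ) :=
  [((0, 0, 1), 2 * (k : ℤ)), ((0, 0, -1), 0), ((0, 1, 0), 2)]

theorem functional_le_of_mem_braidCylinder {n k : ℕ} {H : IntPoint × ℤ}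
    (hH : H ∈ outerHalfSpaces k) {x : R3} (hx : x ∈ braidCylinder n k) :
    IntPoint.functional H.1 x ≤ (H.2 : ℝ) / 2 := by
  obtain ⟨-, ⟨-, h1⟩, h2, h3⟩ := hx
  simp only [outerHalfSpaces, List.mem_cons, List.not_mem_nil, or_false] at hH
  rcases hH with rfl | rfl | rfl <;> simp only [IntPoint.functional_apply] <;> push_cast <;> linarith

/-- A test for an integer edge to lie outside the cylinder. -/
def isOutsideTest (n k : ℕ) (e : IntEdge) : Bool :=
  (outerHalfSpaces k).any fun H =>
    decide (H.2 ≤ IntPoint.dot H.1 e.1) && decide (H.2 ≤ IntPoint.dot H.1 e.2) &&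
    (decide (H.2 < IntPoint.dot H.1 e.1) || decide (H.2 < IntPoint.dot H.1 e.2)) &&
    (decide (H.2 < IntPoint.dot H.1 e.1) || (endpointList n k).contains e.1) &&
    (decide (H.2 < IntPoint.dot H.1 e.2) || (endpointList n k).contains e.2)

/-- The edge lies in a half-space that meets the cylinder at most in its boundary plane, but not
inside that plane. So it can touch the cylinder only with an endpoint, which the test requires to be
an endpoint of the braid. -/
theorem inter_subset_of_isOutsideTest {n k : ℕ} {e : IntEdge} (h : isOutsideTest n k e = true) :
    edgeSegment e.toR3 ∩ braidCylinder n k ⊆ braidEndpoints n k := by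
  rintro x ⟨hx, hx'⟩
  simp only [isOutsideTest, List.any_eq_true, Bool.and_eq_true, Bool.or_eq_true,
    decide_eq_true_eq, List.contains_iff_mem] at h
  obtain ⟨⟨ν, c⟩, hH, ⟨⟨⟨h1, h2⟩, h3⟩, h4⟩, h5⟩ := h
  simp only at h1 h2 h3 h4 h5
  have hle := functional_le_of_mem_braidCylinder hH hx'
  simp only at hle
  have cast_le : ∀ {v : IntPoint}, c ≤ ν.dot v → (c : ℝ) / 2 ≤ ν.functional v.toR3 := fun {v} h => by
    rw [IntPoint.functional_toR3]
    have : (c : ℝ) ≤ ν.dot v := by exact_mod_cast h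
    linarith
  have cast_lt : ∀ {v : IntPoint}, c < ν.dot v → (c : ℝ) / 2 < ν.functional v.toR3 := fun {v} h => by
    rw [IntPoint.functional_toR3]
    have : (c : ℝ) < ν.dot v := by exact_mod_cast h
    linarith
  rcases IntPoint.eq_endpoint_of_linear_le hx (cast_le h1) (cast_le h2)
    (h3.imp cast_lt cast_lt) hle with ⟨rfl, he⟩ | ⟨rfl, he⟩
  · exact toR3_mem_braidEndpoints (h4.resolve_left fun hh => (cast_lt hh).ne' he)
  · exact toR3_mem_braidEndpoints (h5.resolve_left fun hh => (cast_lt hh).ne' he)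

/-- The bound `n ≤ 3` keeps the cylinder within `0 ≤ x ≤ 4`, away from the body. -/
theorem OrientedLink.Realizes.isBraidIn {L : OrientedLink} {E : Set (R3 × R3)} {st X : List IntEdge}
    {n : ℕ} {w : List BraidLetter} (hL : L.Realizes E st) (hE : IsBody E) (hn : n ≤ 3)
    (hX : X.all (isOutsideTest n w.length) = true)
    (hst : sameEdges st (X ++ braidList n w) = true) : L.IsBraidIn n w (E ∪ edgeSet X) := by
  refine ⟨?_, ?_⟩
  · rintro e (he | ⟨e, he, rfl⟩)
    · rintro x ⟨hx, ⟨h0, h1⟩, -⟩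
      have hn' : (n : ℝ) ≤ 3 := by exact_mod_cast hn
      rcases hE e he with h | h
      · linarith [(h x hx).1]
      · linarith [(h x hx).1]
    · exact inter_subset_of_isOutsideTest (List.all_eq_true.1 hX e he)
  · rw [hL, edgeSet_eq_of_sameEdges hst, edgeSet_append, braidEdges_eq_edgeSet, Set.union_assoc]

/-! ### The explicit tangles and the moves between them. -/

open BraidLetter

/-- `t` is obtained from `s` by the moves `ms`. -/
def connects (ms : List PolygonMove) (s t : List IntEdge) : Bool :=
  match applyMoves ms s with
  | some u => sameEdges u t
  | none => false

/-- `t` is obtained from `s` by inserting the vertices `ms`. -/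
def embeds (ms : List (IntPoint × IntPoint)) (s t : List IntEdge) : Bool :=
  match insertVertices ms s with
  | some u => sameEdges u t
  | none => false

namespace OrientedLink

theorem Realizes.congr {L : OrientedLink} {E : Set (R3 × R3)} {s t : List IntEdge}
    (hL : L.Realizes E s) (h : sameEdges s t = true) : L.Realizes E t := by
  rw [Realizes, hL, edgeSet_eq_of_sameEdges h]

theorem exists_of_connects {D : OrientedLink → LaurentPolynomial ℤ} (hD : IsLinkInvariant D)
    {E : Set (R3 × R3)} (hE : IsBody E) {L : OrientedLink} {s t : List IntEdge}
    (hL : L.Realizes E s) (ms : List PolygonMove) (h : connects ms s t = true) :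
    ∃ M : OrientedLink, M.Realizes E t ∧ D M = D L := by
  unfold connects at h
  split at h
  · rename_i u hu
    obtain ⟨M, hM, hDM⟩ := exists_of_applyMoves hD hE hL hu
    exact ⟨M, hM.congr h, hDM⟩
  · exact absurd h (by simp)

theorem exists_of_embeds {E : Set (R3 × R3)} (hE : IsBody E) {L : OrientedLink}
    {s t : List IntEdge} (hL : L.Realizes E s) (ms : List (IntPoint × IntPoint))
    (h : embeds ms s t = true) : ∃ M : OrientedLink, M.Realizes E t := by
  unfold embeds at h
  split at h
  · rename_i u hu
    obtain ⟨M, hM⟩ := exists_of_insertVertices hE hL hu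
    exact ⟨M, hM.congr h⟩
  · exact absurd h (by simp)

end OrientedLink

/-- The strands of the two parts of a split link in normal form. -/
def trivialStrands : List IntEdge :=
  [((-20, 0, 20), (-20, 0, -20)), ((20, 0, 20), (20, 0, -20))]

/-- The two strands in normal form, outside the cylinder of the 2-braids: strand 1 of the braid belongs
to the left part and strand 2 to the right part (for pure braids). -/
def outsideTwo : List IntEdge :=
  [((-20, 0, 20), (2, 0, 4)), ((2, 0, 0), (-20, 0, -20)), ((20, 0, 20), (4, 0, 4)),
   ((4, 0, 0), (20, 0, -20))]

/-- The two strands in normal form, outside the cylinder of the 3-braids. For braids with the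
permutation `(1 3)`, the left part runs through the strands from 1 to 3 and from 2 to 2, and the right
part through the strand from 3 to 1. -/
def outsideThree : List IntEdge :=
  [((-20, 0, 20), (2, 0, 6)), ((6, 0, 0), (12, 4, -2)), ((12, 4, -2), (4, 6, 14)),
   ((4, 6, 14), (4, 0, 6)), ((4, 0, 0), (2, -4, -6)), ((2, -4, -6), (-20, 0, -20)),
   ((20, 0, 20), (6, 0, 6)), ((2, 0, 0), (20, 0, -20))]

/-- Vertices whose insertion into the trivial strands gives the clasp `σ₁²`. -/
def verticesClasp : List (IntPoint × IntPoint) :=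
  [((20, 0, 20), (4, 0, 0)), ((-20, 0, 20), (2, 0, 0)), ((20, 0, 20), (4, 0, 4)),
   ((4, 0, 4), (2, 0, 2)), ((-20, 0, 20), (3, -1, 1)), ((2, 0, 2), (3, 1, 1)),
   ((4, 0, 4), (3, -1, 3)), ((-20, 0, 20), (4, 0, 2)), ((-20, 0, 20), (2, 0, 4)),
   ((2, 0, 4), (3, 1, 3))]

/-- Vertices whose insertion into the trivial strands gives the clasp `σ₁⁻²`. -/
def verticesClaspInv : List (IntPoint × IntPoint) :=
  [((20, 0, 20), (4, 0, 0)), ((-20, 0, 20), (2, 0, 0)), ((20, 0, 20), (4, 0, 4)),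
   ((4, 0, 4), (2, 0, 2)), ((-20, 0, 20), (3, 1, 1)), ((2, 0, 2), (3, -1, 1)),
   ((4, 0, 4), (3, 1, 3)), ((-20, 0, 20), (4, 0, 2)), ((-20, 0, 20), (2, 0, 4)),
   ((2, 0, 4), (3, -1, 3))]

/-- Moves from the trivial strands to the trivial 2-braid. -/
def movesTrivialTwo : List PolygonMove :=
  [.insert (-20, 0, 20) (2, 0, 2), .insert (2, 0, 2) (2, 0, 0), .insert (20, 0, 20) (4, 0, 4),
   .insert (4, 0, 4) (4, 0, 0), .insert (-20, 0, 20) (2, 0, 4), .insert (4, 0, 4) (4, 0, 2)]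

/-- Moves from the trivial strands to the braid `σ₁σ₂σ₁⁻¹`. -/
def movesPosPosNeg : List PolygonMove :=
  [.insert (-20, 0, 20) (2, -4, -6), .insert (-20, 0, 20) (6, 0, 0),
   .insert (20, 0, 20) (5, -1, 3), .insert (6, 0, 0) (3, -1, 5), .insert (6, 0, 0) (12, 4, -2),
   .insert (-20, 0, 20) (6, 0, 2), .insert (20, 0, 20) (6, 0, 6), .insert (5, -1, 3) (3, 1, 1),
   .insert (-20, 0, 20) (3, 1, 5), .insert (6, 0, 6) (6, 0, 4), .insert (3, 1, 5) (4, 0, 4),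
   .insert (3, -1, 5) (4, 0, 0), .insert (4, 0, 4) (5, 1, 3), .insert (3, 1, 1) (2, 0, 0),
   .insert (12, 4, -2) (4, 0, 6), .insert (-20, 0, 20) (2, 0, 6), .insert (5, -1, 3) (4, 0, 2),
   .insert (12, 4, -2) (4, 6, 14), .insert (3, -1, 5) (2, 0, 2), .insert (2, 0, 2) (3, -1, 1),
   .insert (3, -1, 5) (2, 0, 4)]

/-- Moves from the trivial strands to the braid `σ₁⁻¹σ₂⁻¹σ₁`. -/
def movesNegNegPos : List PolygonMove :=
  [.insert (20, 0, 20) (6, 0, 4), .insert (-20, 0, 20) (6, 0, 0), .insert (6, 0, 4) (5, 1, 3),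
   .insert (6, 0, 0) (2, -4, -6), .insert (5, 1, 3) (2, 0, 0), .insert (-20, 0, 20) (3, -1, 5),
   .insert (5, 1, 3) (3, -1, 1), .insert (6, 0, 0) (4, 0, 0), .insert (20, 0, 20) (6, 0, 6),
   .insert (6, 0, 0) (12, 4, -2), .insert (3, -1, 5) (4, 0, 4), .insert (4, 0, 4) (6, 0, 2),
   .insert (4, 0, 4) (5, -1, 3), .insert (12, 4, -2) (3, 1, 5), .insert (12, 4, -2) (4, 0, 6),
   .insert (-20, 0, 20) (2, 0, 6), .insert (5, 1, 3) (4, 0, 2), .insert (12, 4, -2) (4, 6, 14),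
   .insert (3, 1, 5) (2, 0, 2), .insert (2, 0, 2) (3, 1, 1), .insert (3, 1, 5) (2, 0, 4)]

/-- Moves from the clasp `σ₁²` to the braid `σ₁⁻¹σ₂σ₁`. -/
def movesNegPosPos : List PolygonMove :=
  [.delete (3, -1, 3), .delete (3, 1, 1), .delete (2, 0, 0), .delete (4, 0, 2),
   .delete (4, 0, 0), .delete (2, 0, 4), .delete (4, 0, 4), .insert (-20, 0, 20) (3, 1, 1),
   .delete (3, 1, 3), .insert (2, 0, 2) (2, 0, 0), .delete (2, 0, 2),
   .insert (3, 1, 1) (2, -4, -6), .delete (3, -1, 1), .insert (-20, 0, 20) (4, 0, 6),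
   .insert (-20, 0, 20) (3, -1, 5), .insert (3, -1, 5) (12, 4, -2), .insert (3, -1, 5) (5, 1, 3),
   .insert (5, 1, 3) (6, 0, 0), .insert (4, 0, 6) (2, 0, 2), .insert (20, 0, 20) (6, 0, 4),
   .insert (-20, 0, 20) (2, 0, 6), .insert (3, -1, 5) (4, 0, 4), .insert (6, 0, 4) (4, 0, 2),
   .insert (5, 1, 3) (6, 0, 2), .insert (12, 4, -2) (4, 6, 14), .insert (4, 0, 6) (3, 1, 5),
   .insert (20, 0, 20) (6, 0, 6), .insert (3, 1, 5) (2, 0, 4), .insert (3, 1, 1) (4, 0, 0),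
   .insert (4, 0, 2) (3, -1, 1), .insert (6, 0, 4) (5, -1, 3)]

/-- Moves from the clasp `σ₁⁻²` to `claspForTwist`. -/
def movesBeforeTwist : List PolygonMove :=
  [.delete (3, 1, 3), .delete (3, -1, 1), .delete (2, 0, 0), .delete (4, 0, 2),
   .delete (4, 0, 0), .delete (2, 0, 4), .delete (4, 0, 4), .insert (-20, 0, 20) (-19, 0, 20),
   .insert (-19, 0, 20) (-18, 0, 20), .insert (-18, 0, 20) (-17, 0, 20),
   .insert (-17, 0, 20) (-16, 0, 20), .insert (3, 1, 1) (-19, 0, -20),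
   .insert (3, 1, 1) (-18, 0, -20), .insert (3, 1, 1) (-17, 0, -20),
   .insert (3, 1, 1) (-16, 0, -20)]

/-- The clasp `σ₁⁻²`, with the vertices at which the twist turns the left strands. -/
def claspForTwist : List IntEdge :=
  [((-20, 0, 20), (-19, 0, 20)), ((-19, 0, 20), (-18, 0, 20)), ((-18, 0, 20), (-17, 0, 20)),
   ((-17, 0, 20), (-16, 0, 20)), ((-16, 0, 20), (3, -1, 3)), ((3, -1, 3), (3, 1, 1)),
   ((3, 1, 1), (-16, 0, -20)), ((-16, 0, -20), (-17, 0, -20)), ((-17, 0, -20), (-18, 0, -20)),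
   ((-18, 0, -20), (-19, 0, -20)), ((-19, 0, -20), (-20, 0, -20)), ((20, 0, 20), (2, 0, 2)),
   ((2, 0, 2), (20, 0, -20))]

/-- Moves from the twisted clasp `σ₁⁻²` to the braid `σ₁σ₂⁻¹σ₁⁻¹`. -/
def movesAfterTwist : List PolygonMove :=
  [.delete (-18, 0, -20), .delete (-16, 0, -20), .delete (-17, 20, 0), .delete (-19, -20, 0),
   .delete (-16, 0, 20), .delete (-17, -20, 0), .insert (3, 1, 1) (10, 9, -4), .delete (3, 1, 1),
   .insert (10, 9, -4) (8, 7, 0), .delete (10, 9, -4), .insert (8, 7, 0) (16, 11, -1),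
   .delete (8, 7, 0), .insert (-18, 0, 20) (-10, -1, 28), .delete (-18, 0, 20),
   .delete (-19, 20, 0), .insert (2, 0, 2) (-6, 5, 2), .delete (2, 0, 2),
   .insert (-6, 5, 2) (-5, 5, 7), .delete (-6, 5, 2), .insert (3, -1, 3) (1, 6, 4),
   .delete (3, -1, 3), .delete (16, 11, -1), .insert (1, 6, 4) (3, 2, 22), .delete (-10, -1, 28),
   .insert (-20, 0, 20) (12, 4, -2), .delete (1, 6, 4), .insert (20, 0, 20) (5, 5, -3),
   .delete (-5, 5, 7), .insert (3, 2, 22) (2, 0, 4), .insert (-20, 0, 20) (3, 1, 5),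
   .insert (3, 1, 5) (5, -1, 3), .insert (20, 0, 20) (2, 0, 0), .delete (5, 5, -3),
   .insert (12, 4, -2) (4, 6, 14), .delete (3, 2, 22), .insert (2, 0, 4) (2, -4, -6),
   .insert (20, 0, 20) (4, 0, 2), .insert (2, 0, 4) (3, -1, 1), .insert (3, -1, 1) (4, 0, 0),
   .insert (3, 1, 5) (4, 0, 4), .insert (20, 0, 20) (6, 0, 6), .insert (4, 6, 14) (3, -1, 5),
   .insert (4, 6, 14) (4, 0, 6), .insert (4, 0, 2) (3, 1, 1), .insert (5, -1, 3) (6, 0, 0),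
   .insert (5, -1, 3) (6, 0, 2), .insert (2, 0, 4) (2, 0, 2), .insert (6, 0, 6) (5, 1, 3),
   .insert (6, 0, 6) (6, 0, 4), .insert (-20, 0, 20) (2, 0, 6)]

theorem embeds_clasp :
    embeds verticesClasp trivialStrands
      (outsideTwo ++ braidList 2 [sigma 1, sigma 1]) = true := by
  decide +kernel

theorem embeds_claspInv :
    embeds verticesClaspInv trivialStrands
      (outsideTwo ++ braidList 2 [sigmaInv 1, sigmaInv 1]) = true := by
  decide +kernel

theorem connects_trivialTwo :
    connects movesTrivialTwo trivialStrands (outsideTwo ++ braidList 2 [one, one]) = true := by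
  decide +kernel

/-- In the cylinder the strand of the right part runs behind one strand of the left part and in
front of the other. Its two crossings with them have opposite signs, and the parts can be pulled
apart. The same holds for `connects_negNegPos`. -/
theorem connects_posPosNeg :
    connects movesPosPosNeg trivialStrands
      (outsideThree ++ braidList 3 [sigma 1, sigma 2, sigmaInv 1]) = true := by
  decide +kernel

theorem connects_negNegPos :
    connects movesNegNegPos trivialStrands
      (outsideThree ++ braidList 3 [sigmaInv 1, sigmaInv 2, sigma 1]) = true := by
  decide +kernel

/-- Here the strand of the right part passes in front of both strands of the left part, with two
positive crossings, and the parts remain hooked as in the positive clasp. -/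
theorem connects_negPosPos :
    connects movesNegPosPos (outsideTwo ++ braidList 2 [sigma 1, sigma 1])
      (outsideThree ++ braidList 3 [sigmaInv 1, sigma 2, sigma 1]) = true := by
  decide +kernel

theorem connects_beforeTwist :
    connects movesBeforeTwist
      (outsideTwo ++ braidList 2 [sigmaInv 1, sigmaInv 1]) claspForTwist = true := by
  decide +kernel

/-- The strand of the right part passes behind both others, with two negative crossings: the
negative clasp, after the two ends of the left strand have been twisted around each other by the
full turn. -/
theorem connects_afterTwist :
    connects movesAfterTwist (claspForTwist.map fun e => (e.1.twist, e.2.twist))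
      (outsideThree ++ braidList 3 [sigma 1, sigmaInv 2, sigmaInv 1]) = true := by
  decide +kernel

/-! ### Combining the two skein relations. -/

open LaurentPolynomial in
theorem T_two_add_T_neg_two_sub_two_ne_zero : (T 2 + T (-2) - 2 : LaurentPolynomial ℤ) ≠ 0 := by
  intro h
  have h2 : (2 : LaurentPolynomial ℤ) = T 0 + T 0 := by rw [T_zero]; norm_num
  rw [h2] at h
  have := congrArg (fun f : LaurentPolynomial ℤ => f.coeff 2) h
  simp [-T_zero] at this

namespace OrientedLink

theorem endpoints_mem_support {L : OrientedLink} {e : R3 × R3} (he : e ∈ L.edges) :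
    e.1 ∈ L.support ∧ e.2 ∈ L.support :=
  ⟨Set.mem_biUnion he (left_mem_segment ℝ _ _), Set.mem_biUnion he (right_mem_segment ℝ _ _)⟩

theorem eq_zero_of_isSplit {D : OrientedLink → LaurentPolynomial ℤ} (hD : IsLinkInvariant D)
    (hII : SkeinRelationII D) (hIII : SkeinRelationIII D) {L : OrientedLink} (hL : L.IsSplit) :
    D L = 0 := by
  obtain ⟨-, -, A, B, M, -, -, hLM, hM, hA, hB⟩ := hL
  obtain ⟨N, E, hDN, hE, hN⟩ := M.exists_normal_form hD
    (by
      intro e he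
      rw [hM] at he
      rcases he with he | he
      · exact Or.inl ⟨hA _ (endpoints_mem_support he).1, hA _ (endpoints_mem_support he).2⟩
      · exact Or.inr ⟨hB _ (endpoints_mem_support he).1, hB _ (endpoints_mem_support he).2⟩)
    (by
      obtain ⟨e, he⟩ := A.nonempty
      exact ⟨e, hM ▸ Or.inl he, hA _ (endpoints_mem_support he).1⟩)
    (by
      obtain ⟨e, he⟩ := B.nonempty
      exact ⟨e, hM ▸ Or.inr he, hB _ (endpoints_mem_support he).1⟩)
  have hN : N.Realizes E trivialStrands := by
    rw [Realizes, hN, trivialStrands, edgeSet_cons, edgeSet_cons]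
    congr 1
    norm_num [edgeSet, IntEdge.toR3, IntPoint.toR3]
    exact Set.pair_comm _ _
  -- The clasps only have to exist as links with the same body; their values under `D` stay unknown
  -- and cancel in the end.
  obtain ⟨Lp, hLp⟩ := exists_of_embeds hE hN _ embeds_clasp
  obtain ⟨Lm, hLm⟩ := exists_of_embeds hE hN _ embeds_claspInv
  obtain ⟨L0, hL0, hD0⟩ := exists_of_connects hD hE hN _ connects_trivialTwo
  obtain ⟨L₁, hL₁, hD₁⟩ := exists_of_connects hD hE hN _ connects_posPosNeg
  obtain ⟨L₄, hL₄, hD₄⟩ := exists_of_connects hD hE hN _ connects_negNegPos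
  obtain ⟨L₃, hL₃, hD₃⟩ := exists_of_connects hD hE hLp _ connects_negPosPos
  obtain ⟨K, hK, hDK⟩ := exists_of_connects hD hE hLm _ connects_beforeTwist
  obtain ⟨K', hK', hDK'⟩ := exists_of_twist hD hE hK (by decide +kernel)
  obtain ⟨L₂, hL₂, hD₂⟩ := exists_of_connects hD hE hK' _ connects_afterTwist
  have h2 := hII _ Lp Lm L0
    (hLp.isBraidIn hE (by norm_num) (X := outsideTwo) (by decide +kernel) (by decide +kernel))
    (hLm.isBraidIn hE (by norm_num) (X := outsideTwo) (by decide +kernel) (by decide +kernel))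
    (hL0.isBraidIn hE (by norm_num) (X := outsideTwo) (by decide +kernel) (by decide +kernel))
  have h3 := hIII _ L₁ L₂ L₃ L₄
    (hL₁.isBraidIn hE (by norm_num) (X := outsideThree) (by decide +kernel) (by decide +kernel))
    (hL₂.isBraidIn hE (by norm_num) (X := outsideThree) (by decide +kernel) (by decide +kernel))
    (hL₃.isBraidIn hE (by norm_num) (X := outsideThree) (by decide +kernel) (by decide +kernel))
    (hL₄.isBraidIn hE (by norm_num) (X := outsideThree) (by decide +kernel) (by decide +kernel))
  have hLN : D L = D N := (hD _ _ hLM).trans hDN.symm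
  -- After rewriting, `h2` and `h3` evaluate `D Lp + D Lm` as `(t + t⁻¹) D N` and as `2 D N`.
  have key : (LaurentPolynomial.T 2 + LaurentPolynomial.T (-2) - 2) * D N = 0 := by
    rw [hD₁, hD₂, hDK', hDK, hD₃, hD₄] at h3
    rw [hD0] at h2
    linear_combination -h2 - h3
  rw [hLN]
  exact (mul_eq_zero.1 key).resolve_left T_two_add_T_neg_two_sub_two_ne_zero

end OrientedLink

theorem corollary4p4 (D : OrientedLink → LaurentPolynomial ℤ) (hD : IsLinkInvariant D)
    (hII : SkeinRelationII D) (hIII : SkeinRelationIII D) :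
    (∀ L : OrientedLink, L.IsSplit → D L = 0) ∧
    (∀ L O M : OrientedLink, O.IsUnknot → OrientedLink.IsSplitUnion L O M → D M = 0) :=
  ⟨fun _ hL => OrientedLink.eq_zero_of_isSplit hD hII hIII hL,
    fun L O _ _ hM => OrientedLink.eq_zero_of_isSplit hD hII hIII ⟨L, O, hM⟩⟩
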